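/- Let $f:(\mathbb C^2,0)\to(\mathbb C,0)$ be a holomorphic function germ that is mini-regular in $x$ of order $m$: its lowest-degree homogeneous Taylor part $f_m$ has degree $m$ and satisfies $f_m(1,0)\neq 0$. A *Puiseux arc* is a convergent fractional power series $\eta(y)$ with exponents in $\frac1N\mathbb Z_{\ge 0}$ for some $N\geq 1$; a *polar arc* of $f$ is a Puiseux arc $\gamma$ with $\operatorname{ord}\gamma\ge 1$, $f_x(\gamma(y),y)\equiv 0$ and $f(\gamma(y),y)\not\equiv 0$; put $h(\gamma)=\operatorname{ord} f(\gamma(y),y)$. The *gradient degree* $d(\gamma)$ of a polar arc $\gamma$ is the smallest rational $q>0$ such that $\operatorname{ord}\|\operatorname{grad} f(\gamma(y),y)\|=\operatorname{ord}\|\operatorname{grad} f(\gamma(y)+uy^q,y)\|$ for all but finitely many $u\in\mathbb C$. The *gradient canyon* $\mathcal C$ of $\gamma$ is the set of Puiseux arcs $\alpha(y)=\gamma(y)+uy^{d}+\text{h.o.t.}$, $u\in\mathbb C$, where $d=d_{\mathcal C}=d(\gamma)$, i.e. of all $\alpha$ with $\operatorname{ord}(\alpha-\gamma)\ge d$. In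 a Puiseux factorisation $f_x=v\cdot\prod_i(x-\gamma_i(y))$, with $v$ a unit and the roots $\gamma_i$ (Puiseux arcs without constant term) listed with multiplicity, the *polar multiplicity* $\mu_f(\mathcal C)$ is the number of indices $i$ such that the Puiseux arc $\gamma_i$ belongs to $\mathcal C$. The Newton region of $f_x$ relative to a polar arc $\gamma$ is the convex hull of all points $(i+u,j+v)$, $u,v\ge0$, for which $X^iY^j$ occurs with nonzero coefficient in $f_x(X+\gamma(Y),Y)$, and the *augmented Newton polygon* $\widehat{\mathcal{NP}}(f_x,\gamma)$ is the convex hull of this region and the point $(0,h(\gamma)-1)$. A compact edge is a non-degenerate compact segment with endpoints of different abscissae that is an exposed face; the top compact edge is the leftmost one, and its horizontal length is the difference of the abscissae of its endpoints. **Lemma.** Let $\gamma$ be a polar arc of $f$. Its gradient degree exists; let $\mathcal C$ be its gradient canyon, of degree $d_{\mathcal C}$. Then $\mu_f(\mathcal C)$ is well defined (a Puiseux factorisation of $f_x$ exists), the augmented Newton polygon $\widehat{\mathcal{NP}}(f_x,\gamma)$ has a top compact edge $E_{con}$, and $$\operatorname{len}_x(E_{con})=\mu_f(\mathcal C).$$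 If $d_{\mathcal C}>1$, the same holds with $\widehat{\mathcal{NP}}(f_x,\gamma)$ replaced by $\widehat{\mathcal{NP}}(f_x,\gamma')$ for any polar arc $\gamma'\in\mathcal C$. -/

import Mathlib

/-! Function germs at the origin of `ℂ²` are represented by functions `ℂ × ℂ → ℂ` analytic at `0`;
only their values near `0` matter. The first coordinate is `x` and the second one is `y`. -/

/-- The partial derivative `∂G/∂x`. -/
noncomputable def partialX (G : ℂ × ℂ → ℂ) : ℂ × ℂ → ℂ :=
  fun p => deriv (fun x => G (x, p.2)) p.1

/-- The partial derivative `∂G/∂y`. -/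
noncomputable def partialY (G : ℂ × ℂ → ℂ) : ℂ × ℂ → ℂ :=
  fun p => deriv (fun y => G (p.1, y)) p.2

/-- The coefficient of `X ^ i * T ^ k` in the Taylor expansion of `G (X, T)` at the origin. -/
noncomputable def taylorCoeff (G : ℂ × ℂ → ℂ) (i k : ℕ) : ℂ :=
  iteratedDeriv k (fun T => iteratedDeriv i (fun X => G (X, T)) 0) 0 /
    ((i.factorial : ℂ) * (k.factorial : ℂ))

/-- `f` is mini-regular in `x` of order `m`: the Taylor expansion of `f` has no term of total
degree `< m`, and its homogeneous part `f_m` of degree `m` satisfies `f_m (1, 0) ≠ 0`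
(the value `f_m (1, 0)` is the coefficient of `x ^ m`). -/
def IsMiniRegular (f : ℂ × ℂ → ℂ) (m : ℕ) : Prop :=
  (∀ i k : ℕ, i + k < m → taylorCoeff f i k = 0) ∧ taylorCoeff f m 0 ≠ 0

/-- A Puiseux arc, that is, a convergent fractional power series `η(y) = g(y ^ (1 / N))` with
nonnegative exponents, given by the common denominator `N` and the germ `g`. It corresponds to the
parametrisation `t ↦ (g t, t ^ N)`. (The same series has several representatives: `N` may be
replaced by a multiple. All notions below only depend on the series.) -/
structure PuiseuxArc where
  /-- the common denominator `N` of the exponents -/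
  denom : ℕ
  denom_pos : 0 < denom
  /-- the convergent power series `g` with `η(y) = g(y ^ (1 / N))` -/
  toFun : ℂ → ℂ
  analytic : AnalyticAt ℂ toFun 0

/-- The order in `y` of the fractional power series `φ(y ^ (1 / N))` (it is `⊤` for the zero
series). -/
noncomputable def fracOrder (N : ℕ) (φ : ℂ → ℂ) : WithTop ℚ :=
  (analyticOrderAt φ 0).map (fun k : ℕ => (k : ℚ) / (N : ℚ))

namespace PuiseuxArc

/-- The order `ord η(y)` of a Puiseux arc. -/
noncomputable def order (η : PuiseuxArc) : WithTop ℚ := fracOrder η.denom η.toFun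

/-- The order in `y` of `G(η(y), y)`. -/
noncomputable def orderAlong (η : PuiseuxArc) (G : ℂ × ℂ → ℂ) : WithTop ℚ :=
  fracOrder η.denom (fun t => G (η.toFun t, t ^ η.denom))

/-- The order in `y` of `‖grad f(η(y), y)‖`. -/
noncomputable def gradOrder (η : PuiseuxArc) (f : ℂ × ℂ → ℂ) : WithTop ℚ :=
  min (η.orderAlong (partialX f)) (η.orderAlong (partialY f))

/-- The difference `α - β` of two Puiseux arcs, written in the parameter `t` with
`y = t ^ (N_α * N_β)`. -/
def sub (α β : PuiseuxArc) : PuiseuxArc where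
  denom := α.denom * β.denom
  denom_pos := Nat.mul_pos α.denom_pos β.denom_pos
  toFun := fun t => α.toFun (t ^ β.denom) - β.toFun (t ^ α.denom)
  analytic := by
    have ha : AnalyticAt ℂ α.toFun ((fun t : ℂ => t ^ β.denom) 0) := by
      simpa [β.denom_pos.ne'] using α.analytic
    have hb : AnalyticAt ℂ β.toFun ((fun t : ℂ => t ^ α.denom) 0) := by
      simpa [α.denom_pos.ne'] using β.analytic
    exact (AnalyticAt.fun_comp (f := fun t : ℂ => t ^ β.denom) ha (by fun_prop)).sub
      (AnalyticAt.fun_comp (f := fun t : ℂ => t ^ α.denom) hb (by fun_prop))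

/-- The Puiseux arc `γ(y) + u * y ^ q`, for a rational exponent `q ≥ 0`, written in the
parameter `s` with `y = s ^ (N_γ * r)` where `q = p / r`. -/
def addMonomial (γ : PuiseuxArc) (u : ℂ) (q : ℚ) : PuiseuxArc where
  denom := γ.denom * q.den
  denom_pos := Nat.mul_pos γ.denom_pos q.den_pos
  toFun := fun s => γ.toFun (s ^ q.den) + u * s ^ (γ.denom * q.num.toNat)
  analytic := by
    have hg : AnalyticAt ℂ γ.toFun ((fun s : ℂ => s ^ q.den) 0) := by
      simpa [q.den_pos.ne'] using γ.analytic
    exact (AnalyticAt.fun_comp (f := fun s : ℂ => s ^ q.den) hg (by fun_prop)).add (by fun_prop)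

end PuiseuxArc

/-- `γ` is a polar arc of `f`: `ord γ ≥ 1`, `f(γ(y), y)` is not identically zero, and
`f_x(γ(y), y)` is identically zero. -/
def IsPolarArc (f : ℂ × ℂ → ℂ) (γ : PuiseuxArc) : Prop :=
  1 ≤ γ.order ∧ γ.orderAlong f ≠ ⊤ ∧ γ.orderAlong (partialX f) = ⊤

/-- `d` is the gradient degree of `γ`: the smallest (positive, rational) `q` such that
`ord ‖grad f(γ(y), y)‖ = ord ‖grad f(γ(y) + u y ^ q, y)‖` for generic `u`, i.e. for all but
finitely many `u ∈ ℂ`. -/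
def IsGradientDegree (f : ℂ × ℂ → ℂ) (γ : PuiseuxArc) (d : ℚ) : Prop :=
  IsLeast {q : ℚ | 0 < q ∧
    ∀ᶠ u : ℂ in Filter.cofinite, γ.gradOrder f = (γ.addMonomial u q).gradOrder f} d

/-- The gradient canyon of the polar arc `γ` of degree `d`: the set of all Puiseux arcs
`α(y) = γ(y) + u y ^ d + h.o.t.`, `u ∈ ℂ`, that is, with `ord (α - γ) ≥ d`. -/
def gradientCanyon (γ : PuiseuxArc) (d : ℚ) : Set PuiseuxArc :=
  {α | (d : WithTop ℚ) ≤ (α.sub γ).order}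

/-- `G = V * ∏ i, (x - η_i(y))` is a Puiseux factorisation of `G`: `V` is a unit, the `η_i` are
Puiseux arcs without constant term, and the identity is written in the variables `x` and `t`, with
`y = t ^ M` for a common denominator `M` of the `η_i`. -/
def IsPuiseuxFactorisation (G : ℂ × ℂ → ℂ) {n : ℕ} (η : Fin n → PuiseuxArc) : Prop :=
  (∀ i, (η i).toFun 0 = 0) ∧
  ∃ M : ℕ, 0 < M ∧ (∀ i, (η i).denom ∣ M) ∧
    ∃ V : ℂ × ℂ → ℂ, AnalyticAt ℂ V 0 ∧ V 0 ≠ 0 ∧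
      ∀ᶠ p : ℂ × ℂ in nhds 0,
        G (p.1, p.2 ^ M) = V p * ∏ i, (p.1 - (η i).toFun (p.2 ^ (M / (η i).denom)))

/-- `μ` is the polar multiplicity of the canyon `C`: for a Puiseux factorisation of `f_x`, with
roots listed with multiplicity, it is the number of indices `i` such that the root `γ_i` lies
in `C`. -/
def IsPolarMultiplicity (f : ℂ × ℂ → ℂ) (C : Set PuiseuxArc) (μ : ℕ) : Prop :=
  ∃ (n : ℕ) (η : Fin n → PuiseuxArc),
    IsPuiseuxFactorisation (partialX f) η ∧ μ = Set.ncard {i : Fin n | η i ∈ C}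

/-- The Newton dots of `G(X + γ(Y), Y)`: the pairs `(i, j)` such that `X ^ i * Y ^ j` occurs with a
nonzero coefficient. With `Y = T ^ N` these are the pairs `(i, k / N)` such that `X ^ i * T ^ k`
occurs in `G(X + g(T), T ^ N)`. -/
def newtonDots (G : ℂ × ℂ → ℂ) (γ : PuiseuxArc) : Set (ℝ × ℝ) :=
  {p | ∃ i k : ℕ,
    taylorCoeff (fun z : ℂ × ℂ => G (z.1 + γ.toFun z.2, z.2 ^ γ.denom)) i k ≠ 0 ∧
      p = ((i : ℝ), (k : ℝ) / (γ.denom : ℝ))}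

/-- The convex region bounded by the Newton polygon of `G` relative to `γ`: the convex hull of all
points `(i + u, j + v)` with `(i, j)` a dot and `u, v ≥ 0`. -/
def newtonRegion (G : ℂ × ℂ → ℂ) (γ : PuiseuxArc) : Set (ℝ × ℝ) :=
  convexHull ℝ {p | ∃ e ∈ newtonDots G γ, e.1 ≤ p.1 ∧ e.2 ≤ p.2}

/-- The order `h(γ) = ord f(γ(y), y)` as a rational number (meaningful when `f(γ(y), y)` is not
identically zero, as for polar arcs). -/
noncomputable def polarOrder (f : ℂ × ℂ → ℂ) (γ : PuiseuxArc) : ℚ :=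
  (γ.orderAlong f).untopD 0

/-- The augmented Newton polygon of `f_x` along `γ`: the convex hull of the Newton polygon of `f_x`
relative to `γ` and the point `(0, h(γ) - 1)`. (The region is the convex hull of its boundary, so it
makes no difference which of them the point is adjoined to.) -/
noncomputable def augmentedNewtonPolygon (f : ℂ × ℂ → ℂ) (γ : PuiseuxArc) : Set (ℝ × ℝ) :=
  convexHull ℝ (newtonRegion (partialX f) γ ∪ {((0 : ℝ), (polarOrder f γ : ℝ) - 1)})

/-- The segment from `p` (left endpoint) to `q` (right endpoint) is a compact edge of `P`: it is
nondegenerate and is the set of points of `P` where some linear form attains its extremum on `P`. -/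
def IsCompactEdge (P : Set (ℝ × ℝ)) (p q : ℝ × ℝ) : Prop :=
  p.1 < q.1 ∧ IsExposed ℝ P (segment ℝ p q)

/-- The top compact edge of `P`: the leftmost one. -/
def IsTopCompactEdge (P : Set (ℝ × ℝ)) (p q : ℝ × ℝ) : Prop :=
  IsCompactEdge P p q ∧ ∀ p' q', IsCompactEdge P p' q' → p.1 ≤ p'.1

/-!
The argument compares everything with one piecewise affine function. Let `η i` be the Puiseux roots
of `f_x` and, for an arc `γ`, put `φ(q) = ∑ i, min q (ord (η i - γ))` (`contactSum`). Substituting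
`x = γ(y) + z y ^ q` in the factorisation of `f_x` shows two things at once (`exists_isEdge_of_prod`,
`IsEdge.le_order_xCoeff`): `φ(q)` is the order of `f_x` along `γ(y) + u y ^ q` for generic `u`, and
the line of slope `-q` through `(0, φ(q))` supports the Newton polygon of `f_x` relative to `γ`,
touching it last at the abscissa `#{i | ord (η i - γ) ≥ q}`
(`IsPuiseuxFactorisation.newtonDots_supporting_line`).

Let `γ` be a polar arc and `h = ord f(γ(y), y)`. Then `γ` is itself one of the `η i`, so `φ` is
strictly increasing, and it takes the value `h - 1` at a unique `d`, with `d ≥ 1` because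
`φ(1) ≤ m - 1 ≤ h - 1`. This `d` is the gradient degree
(`IsPuiseuxFactorisation.isGradientDegree`). Indeed the chain rule gives `ord f_y = h - 1` along
`γ`; for `q < d` the order of `f_x` along `γ(y) + u y ^ q` is `φ(q) < h - 1`; for `q = d` it is
`h - 1`, while `f` still has order at least `h` there (`IsEdge.le_order_increment`), whence `f_y` has
order at least `h - 1` by the chain rule again, `γ(y) + u y ^ d` having order at least `1`.

So the supporting line of slope `-d` passes through the extra vertex `(0, h - 1)`. As `f_x` vanishes
along `γ`, the Newton polygon itself does not meet the vertical axis, and the segment of this line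
from `(0, h - 1)` to the abscissa `#{i | ord (η i - γ) ≥ d} = μ_f(C)` is the top compact edge
(`topCompactEdge_of_supporting_line`). For another polar arc `γ'` in the canyon, the ultrametric
inequality leaves `min d (ord (η i - γ'))` unchanged, and `d > 1` gives
`ord (f(γ', y) - f(γ, y)) ≥ φ(d) + d > h`, so that `h` is unchanged as well.

Convergent Puiseux roots are constructed in `exists_puiseux_root`: after a translation by an arc
given by the implicit function theorem the coefficient of the next to highest power of `x` vanishes,
and then a blow-up along the steepest side of the Newton polygon lowers the order of vanishing on
`y = 0`. They are split off by dividing convergent power series by `x`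
(`AnalyticAt.exists_eq_add_fst_mul`).
-/

open Filter Topology Finset

attribute [local fun_prop] analyticAt_fst analyticAt_snd

/-! ### Division by `x` and Taylor expansion in `x` -/

/-- The quotient of the increment `p(v, …, v) - p(w, …, w)` by `x`, where `v = (x, y)` and
`w = (0, y)`: the telescoping sum over the slot `k` which receives `(1, 0)`, the slots before it
receiving `v` and the slots after it receiving `w`. -/
noncomputable def divXSeries (p : FormalMultilinearSeries ℂ (ℂ × ℂ) ℂ) :
    FormalMultilinearSeries ℂ (ℂ × ℂ) ℂ := fun n =>
  ∑ k : Fin (n + 1), ((p (n + 1)).curryMid k ((1, 0) : ℂ × ℂ)).compContinuousLinearMap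
    (fun j : Fin n => if j.castSucc < k then ContinuousLinearMap.id ℂ (ℂ × ℂ) else
      (ContinuousLinearMap.inr ℂ ℂ ℂ).comp (ContinuousLinearMap.snd ℂ ℂ ℂ))

lemma mul_divXSeries_apply (p : FormalMultilinearSeries ℂ (ℂ × ℂ) ℂ) (n : ℕ) (v : ℂ × ℂ) :
    v.1 * divXSeries p n (fun _ => v) =
      p (n + 1) (fun _ => v) - p (n + 1) (fun _ => (0, v.2)) := by
  set a : ℕ → Fin (n + 1) → ℂ × ℂ := fun k j => if (j : ℕ) < k then v else (0, v.2) with ha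
  have key : ∀ k : Fin (n + 1), p (n + 1) (a (k + 1)) - p (n + 1) (a k) =
      v.1 * (((p (n + 1)).curryMid k ((1, 0) : ℂ × ℂ)).compContinuousLinearMap
        (fun j : Fin n => if j.castSucc < k then ContinuousLinearMap.id ℂ (ℂ × ℂ) else
        (ContinuousLinearMap.inr ℂ ℂ ℂ).comp (ContinuousLinearMap.snd ℂ ℂ ℂ))) (fun _ => v) := by
    intro k
    have h1 : a (k + 1) = Function.update (a k) k v := by
      ext1 j
      by_cases hj : j = k
      · subst hj; simp [ha]
      · have : (j : ℕ) ≠ k := fun h => hj (Fin.ext h)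
        simp only [ha, Function.update_of_ne hj]
        congr 1
        simp only [eq_iff_iff]; omega
    have h2 : a k = Function.update (a k) k (0, v.2) := by
      ext1 j
      by_cases hj : j = k
      · subst hj; simp [ha]
      · simp [Function.update_of_ne hj]
    have h3 : v - (0, v.2) = v.1 • ((1, 0) : ℂ × ℂ) := by ext <;> simp
    have h4 : p (n + 1) (a (k + 1)) - p (n + 1) (a k) =
        p (n + 1) (Function.update (a k) k (v - (0, v.2))) := by
      rw [ContinuousMultilinearMap.map_update_sub, ← h1, ← h2]
    rw [h4, h3, ContinuousMultilinearMap.map_update_smul, smul_eq_mul,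
      ContinuousMultilinearMap.compContinuousLinearMap_apply,
      ContinuousMultilinearMap.curryMid_apply, ← Fin.insertNth_removeNth]
    congr 3
    ext1 j
    simp only [Fin.removeNth, ha, Fin.val_fin_lt, Fin.succAbove_lt_iff_castSucc_lt]
    split_ifs <;> simp
  have hsum : ∑ k : Fin (n + 1), (p (n + 1) (a (k + 1)) - p (n + 1) (a k)) =
      p (n + 1) (a (n + 1)) - p (n + 1) (a 0) := by
    rw [Fin.sum_univ_eq_sum_range (fun k => p (n + 1) (a (k + 1)) - p (n + 1) (a k)) (n + 1),
      Finset.sum_range_sub (fun k => p (n + 1) (a k))]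
  have e1 : a (n + 1) = fun _ => v := by
    ext1 j
    simp only [ha, j.isLt, if_true]
  have e2 : a 0 = fun _ => (0, v.2) := by ext1 j; simp [ha]
  rw [e1, e2] at hsum
  rw [← hsum, divXSeries, _root_.sum_apply, Finset.mul_sum]
  exact Finset.sum_congr rfl fun k _ => (key k).symm

lemma norm_divXSeries_le (p : FormalMultilinearSeries ℂ (ℂ × ℂ) ℂ) (n : ℕ) :
    ‖divXSeries p n‖ ≤ (n + 1) * ‖p (n + 1)‖ := by
  have : ∀ k : Fin (n + 1), ‖((p (n + 1)).curryMid k ((1, 0) : ℂ × ℂ)).compContinuousLinearMap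
        (fun j : Fin n => if j.castSucc < k then ContinuousLinearMap.id ℂ (ℂ × ℂ) else
        (ContinuousLinearMap.inr ℂ ℂ ℂ).comp (ContinuousLinearMap.snd ℂ ℂ ℂ))‖ ≤ ‖p (n + 1)‖ := by
    intro k
    refine (ContinuousMultilinearMap.norm_compContinuousLinearMap_le _ _).trans ?_
    have h1 : ‖(p (n + 1)).curryMid k ((1, 0) : ℂ × ℂ)‖ ≤ ‖p (n + 1)‖ := by
      refine (ContinuousLinearMap.le_opNorm _ _).trans ?_
      rw [ContinuousMultilinearMap.norm_curryMid]
      simp [Prod.norm_def]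
    have h2 : ∏ j : Fin n, ‖(if j.castSucc < k then ContinuousLinearMap.id ℂ (ℂ × ℂ) else
        (ContinuousLinearMap.inr ℂ ℂ ℂ).comp (ContinuousLinearMap.snd ℂ ℂ ℂ))‖ ≤ 1 := by
      refine Finset.prod_le_one (fun _ _ => norm_nonneg _) fun j _ => ?_
      split_ifs
      · exact ContinuousLinearMap.norm_id_le
      · refine ContinuousLinearMap.opNorm_le_bound _ zero_le_one fun x => ?_
        simp [Prod.norm_def]
    calc _ ≤ ‖p (n + 1)‖ * 1 := mul_le_mul h1 h2 (Finset.prod_nonneg fun _ _ => norm_nonneg _)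
          (norm_nonneg _)
      _ = _ := mul_one _
  refine (norm_sum_le _ _).trans ((Finset.sum_le_sum fun k _ => this k).trans ?_)
  simp

lemma divXSeries_radius_pos (p : FormalMultilinearSeries ℂ (ℂ × ℂ) ℂ) (hp : 0 < p.radius) :
    0 < (divXSeries p).radius := by
  obtain ⟨C, r, hC, hr, h⟩ := p.le_mul_pow_of_radius_pos hp
  have hρ : (0 : ℝ) < 1 / (2 * r) := by positivity
  refine lt_of_lt_of_le ?_ ((divXSeries p).le_radius_of_bound (r := ⟨1 / (2 * r), hρ.le⟩)
    (C * r) fun n => ?_)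
  · exact ENNReal.coe_pos.2 hρ
  · have h2 : ((n : ℝ) + 1) ≤ 2 ^ n := by exact_mod_cast Nat.succ_le_of_lt (Nat.lt_two_pow_self)
    calc ‖divXSeries p n‖ * (1 / (2 * r)) ^ n
        ≤ (2 ^ n * (C * r ^ (n + 1))) * (1 / (2 * r)) ^ n := by
          gcongr
          exact (norm_divXSeries_le p n).trans (mul_le_mul h2 (h _) (norm_nonneg _) (by positivity))
      _ = C * r := by
          rw [div_pow, mul_pow, one_pow]; field_simp; ring

/-- Division of an analytic germ by the first variable. -/
theorem AnalyticAt.exists_eq_add_fst_mul {G : ℂ × ℂ → ℂ} (hG : AnalyticAt ℂ G 0) :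
    ∃ H : ℂ × ℂ → ℂ, AnalyticAt ℂ H 0 ∧ ∀ᶠ v in 𝓝 (0 : ℂ × ℂ), G v = G (0, v.2) + v.1 * H v := by
  obtain ⟨p, r, hp⟩ := hG
  have hpr : 0 < p.radius := hp.r_pos.trans_le hp.r_le
  have hq := (divXSeries p).hasFPowerSeriesOnBall (divXSeries_radius_pos p hpr)
  refine ⟨(divXSeries p).sum, hq.analyticAt, ?_⟩
  have hb : ∀ᶠ v in 𝓝 (0 : ℂ × ℂ), v ∈ Metric.eball (0 : ℂ × ℂ) r :=
    Metric.eball_mem_nhds 0 hp.r_pos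
  have hb' : ∀ᶠ v in 𝓝 (0 : ℂ × ℂ), ((0 : ℂ), v.2) ∈ Metric.eball (0 : ℂ × ℂ) r := by
    have : Tendsto (fun v : ℂ × ℂ => ((0 : ℂ), v.2)) (𝓝 0) (𝓝 0) := by
      have : Continuous (fun v : ℂ × ℂ => ((0 : ℂ), v.2)) := by fun_prop
      exact this.tendsto' 0 0 rfl
    exact this hb
  filter_upwards [hb, hb', Metric.eball_mem_nhds 0 (divXSeries_radius_pos p hpr)] with v h1 h2 h3
  have s1 := hp.hasSum h1
  have s2 := hp.hasSum h2
  have s3 := (hq.hasSum h3).mul_left v.1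
  simp only [zero_add] at s1 s2 s3
  have s4 := s1.sub s2
  rw [← hasSum_nat_add_iff' 1] at s4
  simp only [mul_divXSeries_apply] at s3
  have := s3.unique s4
  simp only [Finset.sum_range_one] at this
  have e0 : p 0 (fun _ => v) = p 0 (fun _ => (0, v.2)) := by
    congr 1; ext1 j; exact j.elim0
  rw [e0] at this
  rw [this]; ring

/-- The coefficient of `x ^ i` in the expansion of `G (x, y)` in powers of `x`, as a function
of `y`. -/
noncomputable def xCoeff (G : ℂ × ℂ → ℂ) (i : ℕ) (y : ℂ) : ℂ :=
  iteratedDeriv i (fun x => G (x, y)) 0 / (i.factorial : ℂ)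

lemma iteratedDeriv_of_eventuallyEq_sum {g K : ℂ → ℂ} {a : ℕ → ℂ} {n : ℕ} (hK : AnalyticAt ℂ K 0)
    (h : ∀ᶠ x in 𝓝 0, g x = ∑ i ∈ range n, a i * x ^ i + x ^ n * K x) {i : ℕ} (hi : i < n) :
    iteratedDeriv i g 0 / (i.factorial : ℂ) = a i := by
  have h1 : AnalyticAt ℂ (fun x : ℂ => ∑ i ∈ range n, a i * x ^ i) 0 :=
    Finset.analyticAt_fun_sum _ fun i _ => by fun_prop
  have h2 : AnalyticAt ℂ (fun x : ℂ => x ^ n * K x) 0 := by fun_prop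
  have h3 : iteratedDeriv i (fun x : ℂ => x ^ n * K x) 0 = 0 := by
    refine (natCast_le_analyticOrderAt_iff_iteratedDeriv_eq_zero h2 (n := n)).1 ?_ i hi
    rw [natCast_le_analyticOrderAt h2]
    exact ⟨K, hK, Eventually.of_forall fun z => by simp⟩
  have h4 := Filter.EventuallyEq.iteratedDeriv_eq i
    (show g =ᶠ[𝓝 0] fun x => ∑ i ∈ range n, a i * x ^ i + x ^ n * K x from h)
  rw [h4, iteratedDeriv_fun_add h1.contDiffAt h2.contDiffAt, h3, add_zero]
  simp (disch := fun_prop) only [iteratedDeriv_fun_sum, iteratedDeriv_const_mul_field,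
    iteratedDeriv_fun_pow_zero]
  have := Nat.factorial_ne_zero i
  simp [Finset.sum_ite_eq_of_mem _ _ _ (Finset.mem_range.mpr hi)]
  field_simp

lemma AnalyticAt.exists_taylor_fst_aux {G : ℂ × ℂ → ℂ} (hG : AnalyticAt ℂ G 0) (n : ℕ) :
    ∃ c : ℕ → ℂ → ℂ, (∀ i < n, AnalyticAt ℂ (c i) 0) ∧ ∃ H : ℂ × ℂ → ℂ, AnalyticAt ℂ H 0 ∧
      ∀ᶠ v in 𝓝 (0 : ℂ × ℂ), G v = ∑ i ∈ range n, c i v.2 * v.1 ^ i + v.1 ^ n * H v := by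
  induction n with
  | zero => exact ⟨fun _ _ => 0, by simp, G, hG, by simp⟩
  | succ n ih =>
    obtain ⟨c, hc, H, hH, h⟩ := ih
    obtain ⟨K, hK, h'⟩ := hH.exists_eq_add_fst_mul
    refine ⟨fun i => if i < n then c i else fun y => H (0, y), fun i _ => ?_, K, hK, ?_⟩
    · by_cases hi : i < n <;> simp only [hi, if_true, if_false]
      · exact hc i hi
      · exact AnalyticAt.comp (g := H) (f := fun y : ℂ => ((0 : ℂ), y)) hH (by fun_prop)
    · filter_upwards [h, h'] with v h1 h2
      rw [h1, h2, Finset.sum_range_succ]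
      have : ∑ i ∈ range n, (if i < n then c i else fun y => H (0, y)) v.2 * v.1 ^ i =
          ∑ i ∈ range n, c i v.2 * v.1 ^ i :=
        Finset.sum_congr rfl fun i hi => by rw [if_pos (Finset.mem_range.1 hi)]
      rw [this]; simp; ring

lemma AnalyticAt.xCoeff_eventuallyEq {G H : ℂ × ℂ → ℂ} {n : ℕ} {c : ℕ → ℂ → ℂ}
    (hH : AnalyticAt ℂ H 0)
    (h : ∀ᶠ v in 𝓝 (0 : ℂ × ℂ), G v = ∑ i ∈ range n, c i v.2 * v.1 ^ i + v.1 ^ n * H v)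
    {i : ℕ} (hi : i < n) : xCoeff G i =ᶠ[𝓝 0] c i := by
  have h0 : Tendsto (fun y : ℂ => ((0 : ℂ), y)) (𝓝 0) (𝓝 (0 : ℂ × ℂ)) :=
    (show Continuous (fun y : ℂ => ((0 : ℂ), y)) by fun_prop).tendsto' 0 0 rfl
  filter_upwards [h0.eventually hH.eventually_analyticAt, h0.eventually h.eventually_nhds]
    with y h1 h2
  have h3 : Tendsto (fun x : ℂ => (x, y)) (𝓝 0) (𝓝 ((0 : ℂ), y)) :=
    (show Continuous (fun x : ℂ => (x, y)) by fun_prop).tendsto' 0 _ rfl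
  exact iteratedDeriv_of_eventuallyEq_sum (a := fun i => c i y) (K := fun x => H (x, y))
    (AnalyticAt.comp (g := H) (f := fun x : ℂ => (x, y)) h1 (by fun_prop)) (h3.eventually h2) hi

lemma AnalyticAt.xCoeff {G : ℂ × ℂ → ℂ} (hG : AnalyticAt ℂ G 0) (i : ℕ) :
    AnalyticAt ℂ (xCoeff G i) 0 := by
  obtain ⟨c, hc, H, hH, h⟩ := hG.exists_taylor_fst_aux (i + 1)
  exact (hc i i.lt_succ_self).congr (hH.xCoeff_eventuallyEq h i.lt_succ_self).symm

/-- Taylor's formula in the first variable, with a remainder analytic in both variables. -/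
theorem AnalyticAt.exists_taylor_fst {G : ℂ × ℂ → ℂ} (hG : AnalyticAt ℂ G 0) (n : ℕ) :
    ∃ H : ℂ × ℂ → ℂ, AnalyticAt ℂ H 0 ∧
      ∀ᶠ v in 𝓝 (0 : ℂ × ℂ),
        G v = ∑ i ∈ range n, _root_.xCoeff G i v.2 * v.1 ^ i + v.1 ^ n * H v := by
  obtain ⟨c, hc, H, hH, h⟩ := hG.exists_taylor_fst_aux n
  refine ⟨H, hH, ?_⟩
  have h2 : Tendsto (fun v : ℂ × ℂ => v.2) (𝓝 0) (𝓝 0) := continuous_snd.tendsto' 0 0 rfl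
  have h3 : ∀ᶠ v in 𝓝 (0 : ℂ × ℂ), ∀ i ∈ range n, _root_.xCoeff G i v.2 = c i v.2 := by
    rw [Filter.eventually_all_finset]
    exact fun i hi => h2.eventually (hH.xCoeff_eventuallyEq h (Finset.mem_range.1 hi))
  filter_upwards [h, h3] with v h4 h5
  rw [h4]
  congr 1
  exact Finset.sum_congr rfl fun i hi => by rw [h5 i hi]

/-! ### Partial derivatives, implicit functions and orders of vanishing -/

lemma AnalyticAt.partialX_eventuallyEq {G : ℂ × ℂ → ℂ} {a : ℂ × ℂ} (hG : AnalyticAt ℂ G a) :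
    partialX G =ᶠ[𝓝 a] fun v => fderiv ℂ G v (1, 0) := by
  filter_upwards [hG.eventually_analyticAt] with v hv
  have h := hv.differentiableAt.hasFDerivAt.comp_hasDerivAt v.1
    ((hasDerivAt_id v.1).prodMk (hasDerivAt_const v.1 v.2))
  exact h.deriv

lemma AnalyticAt.partialY_eventuallyEq {G : ℂ × ℂ → ℂ} {a : ℂ × ℂ} (hG : AnalyticAt ℂ G a) :
    partialY G =ᶠ[𝓝 a] fun v => fderiv ℂ G v (0, 1) := by
  filter_upwards [hG.eventually_analyticAt] with v hv
  have h := hv.differentiableAt.hasFDerivAt.comp_hasDerivAt v.2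
    ((hasDerivAt_const v.2 v.1).prodMk (hasDerivAt_id v.2))
  exact h.deriv

lemma AnalyticAt.partialX {G : ℂ × ℂ → ℂ} {a : ℂ × ℂ} (hG : AnalyticAt ℂ G a) :
    AnalyticAt ℂ (partialX G) a :=
  (((ContinuousLinearMap.apply ℂ ℂ ((1, 0) : ℂ × ℂ)).analyticAt _).comp hG.fderiv).congr
    hG.partialX_eventuallyEq.symm

lemma AnalyticAt.partialY {G : ℂ × ℂ → ℂ} {a : ℂ × ℂ} (hG : AnalyticAt ℂ G a) :
    AnalyticAt ℂ (partialY G) a :=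
  (((ContinuousLinearMap.apply ℂ ℂ ((0, 1) : ℂ × ℂ)).analyticAt _).comp hG.fderiv).congr
    hG.partialY_eventuallyEq.symm

lemma iterate_partialX_apply (G : ℂ × ℂ → ℂ) (n : ℕ) (x y : ℂ) :
    (partialX^[n] G) (x, y) = iteratedDeriv n (fun x => G (x, y)) x := by
  induction n generalizing x with
  | zero => simp
  | succ n ih =>
    rw [Function.iterate_succ', Function.comp_apply, iteratedDeriv_succ]
    simp only [partialX, ih]

lemma AnalyticAt.iterate_partialX {G : ℂ × ℂ → ℂ} {a : ℂ × ℂ} (hG : AnalyticAt ℂ G a) (n : ℕ) :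
    AnalyticAt ℂ (_root_.partialX^[n] G) a := by
  induction n with
  | zero => exact hG
  | succ n ih => rw [Function.iterate_succ']; exact ih.partialX

lemma xCoeff_partialX (G : ℂ × ℂ → ℂ) (i : ℕ) (y : ℂ) :
    xCoeff (partialX G) i y = (i + 1) * xCoeff G (i + 1) y := by
  have h : (fun x => partialX G (x, y)) = deriv (fun x => G (x, y)) := rfl
  have h1 : (i.factorial : ℂ) ≠ 0 := by exact_mod_cast i.factorial_ne_zero
  have h2 : (i : ℂ) + 1 ≠ 0 := by exact_mod_cast i.succ_ne_zero
  rw [xCoeff, xCoeff, h, iteratedDeriv_succ', Nat.factorial_succ]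
  push_cast
  field_simp

/-- The implicit function theorem for analytic germs in two variables. -/
lemma AnalyticAt.exists_implicit {K : ℂ × ℂ → ℂ} (hK : AnalyticAt ℂ K 0) (h0 : K 0 = 0)
    (h1 : deriv (fun x => K (x, 0)) 0 ≠ 0) :
    ∃ a : ℂ → ℂ, AnalyticAt ℂ a 0 ∧ a 0 = 0 ∧ ∀ᶠ y in 𝓝 0, K (a y, y) = 0 := by
  set F : ℂ × ℂ → ℂ := fun v => K (v.2, v.1) with hF
  have hFa : AnalyticAt ℂ F 0 :=
    AnalyticAt.comp (g := K) (f := fun v : ℂ × ℂ => (v.2, v.1)) hK (by fun_prop)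
  have cd : ContDiffAt ℂ ⊤ F ((0 : ℂ), (0 : ℂ)) := hFa.contDiffAt
  have hinr : fderiv ℂ F ((0 : ℂ), (0 : ℂ)) ∘L .inr ℂ ℂ ℂ =
      (ContinuousLinearEquiv.unitsEquivAut ℂ (Units.mk0 _ h1) : ℂ →L[ℂ] ℂ) := by
    have h := hFa.differentiableAt.hasFDerivAt.comp_hasDerivAt (0 : ℂ)
      ((hasDerivAt_const (0 : ℂ) (0 : ℂ)).prodMk (hasDerivAt_id (0 : ℂ)))
    have h' := h.deriv
    ext
    simp only [ContinuousLinearMap.comp_apply, ContinuousLinearMap.inr_apply]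
    change fderiv ℂ F 0 (0, 1) = _
    rw [← h']
    simp [ContinuousLinearEquiv.unitsEquivAut, Function.comp_def, hF]
  have hinv : (fderiv ℂ F ((0 : ℂ), (0 : ℂ)) ∘L .inr ℂ ℂ ℂ).IsInvertible := ⟨_, hinr.symm⟩
  have hn : (⊤ : WithTop ℕ∞) ≠ 0 := by simp
  refine ⟨cd.implicitFunction hn hinv, (cd.contDiffAt_implicitFunction hn hinv).analyticAt,
    cd.implicitFunction_apply_self hn hinv, ?_⟩
  have := cd.eventually_apply_implicitFunction hn hinv
  have hF0 : F (0, 0) = 0 := h0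
  filter_upwards [this] with y hy
  rw [hF0] at hy
  exact hy

lemma ENat.eq_of_natCast_add_eq {k : ℕ} {a b : ℕ∞} (h : (k : ℕ∞) + a = k + b) : a = b :=
  (WithTop.add_left_inj (ENat.natCast_ne_top k)).1 h

lemma analyticOrderAt_pow_mul {g : ℂ → ℂ} (hg : AnalyticAt ℂ g 0) (k : ℕ) :
    analyticOrderAt (fun t => t ^ k * g t) 0 = k + analyticOrderAt g 0 := by
  have h := analyticOrderAt_mul (f := fun t : ℂ => t ^ k) (g := g) (z₀ := 0) (by fun_prop) hg
  have h2 : analyticOrderAt (fun t : ℂ => t ^ k) 0 = k := by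
    have := analyticOrderAt_centeredMonomial (𝕜 := ℂ) (z₀ := 0) (n := k)
    simpa [Pi.pow_def] using this
  rw [← h2, ← h]; rfl

lemma analyticOrderAt_comp_pow {φ : ℂ → ℂ} (hφ : AnalyticAt ℂ φ 0) {k : ℕ} (hk : 0 < k) :
    analyticOrderAt (fun t => φ (t ^ k)) 0 = k * analyticOrderAt φ 0 := by
  have h0 : (fun t : ℂ => t ^ k) 0 = 0 := by simp [hk.ne']
  have h := AnalyticAt.analyticOrderAt_comp (f := φ) (g := fun t : ℂ => t ^ k) (z₀ := 0)
    (by simpa [hk.ne'] using hφ) (by fun_prop)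
  have h2 : analyticOrderAt (fun t : ℂ => t ^ k) 0 = k := by
    have h1 : analyticOrderAt (fun _ : ℂ => (1 : ℂ)) 0 = 0 :=
      analyticAt_const.analyticOrderAt_eq_zero.2 one_ne_zero
    simpa [h1] using analyticOrderAt_pow_mul (g := fun _ => 1) analyticAt_const k
  simp only [h0, sub_zero] at h
  rw [h2, mul_comm] at h
  exact h

lemma natCast_le_analyticOrderAt_zero {g : ℂ → ℂ} (hg : AnalyticAt ℂ g 0) {k : ℕ} :
    (k : ℕ∞) ≤ analyticOrderAt g 0 ↔
      ∃ h : ℂ → ℂ, AnalyticAt ℂ h 0 ∧ ∀ᶠ t in 𝓝 0, g t = t ^ k * h t := by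
  simpa using natCast_le_analyticOrderAt hg (n := k)

/-- A polynomial of degree `n + 1` without term of degree `n` which is not a monomial is not a
constant multiple of the `(n + 1)`-th power of a linear polynomial, so it has a root of multiplicity
less than `n + 1`. -/
lemma Polynomial.exists_isRoot_rootMultiplicity_lt {P : Polynomial ℂ} {n : ℕ}
    (hn : P.natDegree = n + 1) (h1 : P.coeff n = 0) (h2 : ∃ i ≤ n, P.coeff i ≠ 0) :
    ∃ z, P.IsRoot z ∧ P.rootMultiplicity z < n + 1 := by
  have hP : P ≠ 0 := by rintro rfl; simp at hn
  obtain ⟨z, hz⟩ := IsAlgClosed.exists_root P (by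
    rw [Polynomial.degree_eq_natDegree hP, hn]; exact_mod_cast n.succ_ne_zero)
  refine ⟨z, hz, lt_of_not_ge fun hle => ?_⟩
  obtain ⟨R, hR⟩ := (Polynomial.le_rootMultiplicity_iff hP).1 hle
  have hR0 : R ≠ 0 := by rintro rfl; simp [hP] at hR
  have hdeg : R.natDegree = 0 := by
    have := congrArg Polynomial.natDegree hR
    rw [Polynomial.natDegree_mul (pow_ne_zero _ (Polynomial.X_sub_C_ne_zero z)) hR0, hn] at this
    simp at this
    omega
  obtain ⟨b, rfl⟩ := Polynomial.natDegree_eq_zero.1 hdeg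
  have hb : b ≠ 0 := by rintro rfl; simp at hR0
  have hz0 : z = 0 := by
    rw [hR, Polynomial.coeff_mul_C, sub_eq_add_neg, ← Polynomial.C_neg,
      Polynomial.coeff_X_add_C_pow] at h1
    have : ((n : ℂ) + 1) ≠ 0 := by exact_mod_cast n.succ_ne_zero
    simpa [hb, this] using h1
  obtain ⟨i, hi, hi'⟩ := h2
  rw [hR, hz0] at hi'
  simp [Polynomial.coeff_X_pow] at hi'
  omega

lemma Polynomial.analyticOrderAt_eval_add {P : Polynomial ℂ} (hP : P ≠ 0) (z : ℂ) :
    analyticOrderAt (fun x => P.eval (z + x)) 0 = P.rootMultiplicity z := by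
  obtain ⟨R, hR, hR'⟩ := Polynomial.exists_eq_pow_rootMultiplicity_mul_and_not_dvd P hP z
  have han : AnalyticAt ℂ (fun x => R.eval (z + x)) 0 := by
    simpa using AnalyticAt.aeval_polynomial (f := fun x : ℂ => z + x) (by fun_prop) R
  have : (fun x => P.eval (z + x)) =
      fun x => x ^ P.rootMultiplicity z * R.eval (z + x) := by
    ext1 x
    conv_lhs => rw [hR]
    simp
  rw [this, analyticOrderAt_pow_mul han, (han.analyticOrderAt_eq_zero).2, add_zero]
  rw [Polynomial.dvd_iff_isRoot] at hR'
  simpa using hR'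

/-! ### Newton–Puiseux factorisation -/

/-- Comparison of the slopes of a Newton polygon: the point at abscissa `i` realises the steepest slope
seen from the point `(n, 0)`. -/
lemma exists_steepest_vertex {n : ℕ} (o : ℕ → ℕ∞) (h0 : o 0 ≠ ⊤) (hn : 0 < n) :
    ∃ i < n, o i ≠ ⊤ ∧ ∀ j < n, (((o i).toNat * (n - j) : ℕ) : ℕ∞) ≤ ((n - i : ℕ) : ℕ∞) * o j := by
  classical
  obtain ⟨i, hi, hmin⟩ := Finset.exists_min_image ((range n).filter fun i => o i ≠ ⊤)
    (fun i => ((o i).toNat : ℚ) / ((n - i : ℕ) : ℚ)) ⟨0, by simp [h0, hn]⟩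
  simp only [Finset.mem_filter, Finset.mem_range] at hi hmin
  refine ⟨i, hi.1, hi.2, fun j hj => ?_⟩
  have hni : 0 < n - i := by omega
  have hnj : 0 < n - j := by omega
  by_cases hoj : o j = ⊤
  · rw [hoj, ENat.mul_top (by exact_mod_cast hni.ne')]
    exact le_top
  · have h := hmin j ⟨hj, hoj⟩
    rw [div_le_div_iff₀ (by exact_mod_cast hni) (by exact_mod_cast hnj)] at h
    rw [← ENat.natCast_toNat hoj]
    norm_cast at h ⊢
    linarith

/-- **Newton–Puiseux**, existence of one root: if `G (x, 0)` vanishes at `0` to a finite positive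
order, then `G` vanishes along some convergent Puiseux arc through the origin. -/
theorem exists_puiseux_root (n : ℕ) : ∀ {G : ℂ × ℂ → ℂ}, AnalyticAt ℂ G 0 →
    analyticOrderAt (fun x => G (x, 0)) 0 = ((n + 1 : ℕ) : ℕ∞) →
    ∃ M : ℕ, 0 < M ∧ ∃ η : ℂ → ℂ, AnalyticAt ℂ η 0 ∧ η 0 = 0 ∧
      ∀ᶠ t in 𝓝 0, G (η t, t ^ M) = 0 := by
  induction n using Nat.strong_induction_on with
  | _ n ih =>
  intro G hG hord
  have hGx : AnalyticAt ℂ (fun x : ℂ => G (x, 0)) 0 :=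
    AnalyticAt.comp (g := G) (f := fun x : ℂ => (x, (0 : ℂ))) hG (by fun_prop)
  have hder := (analyticOrderAt_eq_nat_iff_iteratedDeriv_eq_zero hGx).1 hord
  -- the zero of the `n`-th derivative is simple; translate by it so that the coefficient of `x ^ n` vanishes identically
  obtain ⟨a, ha, ha0, haK⟩ := (hG.iterate_partialX n).exists_implicit
    (by
      change (partialX^[n] G) (0, 0) = 0
      rw [iterate_partialX_apply]; exact hder.1 n n.lt_succ_self)
    (by
      simp only [iterate_partialX_apply]
      rw [← iteratedDeriv_succ (f := fun x => G (x, 0))]; exact hder.2)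
  set G₂ : ℂ × ℂ → ℂ := fun v => G (v.1 + a v.2, v.2) with hG₂
  have ha2 : AnalyticAt ℂ (fun v : ℂ × ℂ => a v.2) 0 :=
    AnalyticAt.comp (g := a) (f := fun v : ℂ × ℂ => v.2) ha (by fun_prop)
  have hG₂a : AnalyticAt ℂ G₂ 0 :=
    hG.comp_of_eq (f := fun v : ℂ × ℂ => (v.1 + a v.2, v.2)) (by fun_prop) (by simp [ha0])
  have hca : ∀ i, AnalyticAt ℂ (xCoeff G₂ i) 0 := hG₂a.xCoeff
  have hc : ∀ i y, xCoeff G₂ i y = iteratedDeriv i (fun x => G (x, y)) (a y) / i.factorial := by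
    intro i y
    have := congrFun (iteratedDeriv_comp_add_const i (fun x => G (x, y)) (a y)) 0
    simp only [zero_add] at this
    rw [xCoeff, ← this]
  have hc0 : ∀ i ≤ n, xCoeff G₂ i 0 = 0 := fun i hi => by
    rw [hc, ha0, hder.1 i (by omega), zero_div]
  have hctop : xCoeff G₂ (n + 1) 0 ≠ 0 := by
    rw [hc, ha0]
    exact div_ne_zero hder.2 (by exact_mod_cast (n + 1).factorial_ne_zero)
  have hcn : ∀ᶠ y in 𝓝 0, xCoeff G₂ n y = 0 := by
    filter_upwards [haK] with y hy
    rw [iterate_partialX_apply] at hy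
    rw [hc, hy, zero_div]
  -- if the constant term vanishes identically then `a` itself is a root
  by_cases h00 : analyticOrderAt (xCoeff G₂ 0) 0 = ⊤
  · refine ⟨1, one_pos, a, ha, ha0, ?_⟩
    filter_upwards [analyticOrderAt_eq_top.1 h00] with y hy
    rw [hc] at hy
    simpa using hy
  obtain ⟨i₀, hi₀, hi₀t, hmin⟩ :=
    exists_steepest_vertex (fun i => analyticOrderAt (xCoeff G₂ i) 0) h00 n.succ_pos
  -- the steepest side of the Newton polygon, of slope `p / r`
  set p := (analyticOrderAt (xCoeff G₂ i₀) 0).toNat with hp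
  set r := n + 1 - i₀ with hr
  have hr0 : 0 < r := by omega
  have hp' : analyticOrderAt (xCoeff G₂ i₀) 0 = p := (ENat.natCast_toNat hi₀t).symm
  have hp0 : 0 < p := by
    refine Nat.pos_of_ne_zero fun h => ?_
    rw [h, Nat.cast_zero, (hca i₀).analyticOrderAt_eq_zero] at hp'
    exact hp' (hc0 i₀ (by omega))
  have hcomp : ∀ i, AnalyticAt ℂ (fun t => xCoeff G₂ i (t ^ r)) 0 := fun i =>
    (hca i).comp_of_eq (f := fun t : ℂ => t ^ r) (by fun_prop) (by simp [hr0.ne'])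
  have hE : ∀ i, ∃ E : ℂ → ℂ, AnalyticAt ℂ E 0 ∧
      ∀ᶠ t in 𝓝 0, xCoeff G₂ i (t ^ r) = t ^ (p * (n + 1 - i)) * E t := by
    intro i
    rw [← natCast_le_analyticOrderAt_zero (hcomp i)]
    by_cases hi : i < n + 1
    · rw [analyticOrderAt_comp_pow (hca i) hr0]
      exact hmin i hi
    · have : n + 1 - i = 0 := by omega
      simp [this]
  choose E hEa hE using hE
  have hEord : ∀ i, r * analyticOrderAt (xCoeff G₂ i) 0 =
      ((p * (n + 1 - i) : ℕ) : ℕ∞) + analyticOrderAt (E i) 0 := by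
    intro i
    rw [← analyticOrderAt_comp_pow (hca i) hr0, ← analyticOrderAt_pow_mul (hEa i)]
    exact analyticOrderAt_congr (hE i)
  have hEi₀ : E i₀ 0 ≠ 0 := by
    rw [← (hEa i₀).analyticOrderAt_eq_zero]
    have h := hEord i₀
    rw [hp', ← hr, mul_comm p r] at h
    have h2 : ((r * p : ℕ) : ℕ∞) + 0 = ((r * p : ℕ) : ℕ∞) + analyticOrderAt (E i₀) 0 := by
      rw [← h]; push_cast; simp
    exact (ENat.eq_of_natCast_add_eq h2).symm
  have hEn : E n 0 = 0 := by
    have h := hEord n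
    rw [analyticOrderAt_eq_top.2 hcn, ENat.mul_top (by exact_mod_cast hr0.ne')] at h
    have h2 : analyticOrderAt (E n) 0 = ⊤ := by
      by_contra hne
      exact (WithTop.add_ne_top.2 ⟨ENat.natCast_ne_top _, hne⟩) h.symm
    exact apply_eq_zero_of_analyticOrderAt_ne_zero (by simp [h2])
  have hEtop : E (n + 1) 0 ≠ 0 := by
    have := (hE (n + 1)).self_of_nhds
    simp only [Nat.sub_self, mul_zero, pow_zero, one_mul, zero_pow hr0.ne'] at this
    rwa [← this]
  -- the exceptional polynomial of the blow-up `x = t ^ p * z`, `y = t ^ r`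
  set P : Polynomial ℂ := ∑ i ∈ range (n + 2), Polynomial.C (E i 0) * Polynomial.X ^ i with hP
  have hPc : ∀ i < n + 2, P.coeff i = E i 0 := by
    intro i hi
    rw [hP, Polynomial.finsetSum_coeff]
    simp [Polynomial.coeff_X_pow, hi]
  have hPd : P.natDegree = n + 1 := by
    refine le_antisymm (Polynomial.natDegree_sum_le_of_forall_le _ _ fun i hi => ?_)
      (Polynomial.le_natDegree_of_ne_zero (by rwa [hPc _ (by omega)]))
    exact (Polynomial.natDegree_C_mul_X_pow_le _ _).trans (by simp at hi; omega)
  have hP0 : P ≠ 0 := by rintro h; simp [h] at hPd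
  obtain ⟨z₀, hz₀, hmult⟩ := Polynomial.exists_isRoot_rootMultiplicity_lt hPd
    (by rw [hPc _ (by omega), hEn]) ⟨i₀, by omega, by rwa [hPc _ (by omega)]⟩
  -- the strict transform, centred at the root `z₀` of `P`
  obtain ⟨H, hH, hTaylor⟩ := hG₂a.exists_taylor_fst (n + 2)
  set Q : ℂ × ℂ → ℂ := fun v => ∑ i ∈ range (n + 2), E i v.2 * (z₀ + v.1) ^ i +
    v.2 ^ p * (z₀ + v.1) ^ (n + 2) * H (v.2 ^ p * (z₀ + v.1), v.2 ^ r) with hQ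
  have hQa : AnalyticAt ℂ Q 0 := by
    have h1 : ∀ i, AnalyticAt ℂ (fun v : ℂ × ℂ => E i v.2) 0 := fun i =>
      AnalyticAt.comp (g := E i) (f := fun v : ℂ × ℂ => v.2) (hEa i) (by fun_prop)
    have h2 : AnalyticAt ℂ (fun v : ℂ × ℂ => H (v.2 ^ p * (z₀ + v.1), v.2 ^ r)) 0 :=
      hH.comp_of_eq (f := fun v : ℂ × ℂ => (v.2 ^ p * (z₀ + v.1), v.2 ^ r)) (by fun_prop)
        (by simp [hp0.ne', hr0.ne'])
    refine AnalyticAt.add (Finset.analyticAt_fun_sum _ fun i _ => ?_) ?_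
    · exact (h1 i).mul (by fun_prop)
    · exact AnalyticAt.mul (f := fun v : ℂ × ℂ => v.2 ^ p * (z₀ + v.1) ^ (n + 2)) (by fun_prop) h2
  have hQord : analyticOrderAt (fun x => Q (x, 0)) 0 = P.rootMultiplicity z₀ := by
    rw [← Polynomial.analyticOrderAt_eval_add hP0]
    congr 1
    ext1 x
    simp [hQ, hP, hp0.ne', Polynomial.eval_finsetSum]
  obtain ⟨ν, hν⟩ := Nat.exists_eq_succ_of_ne_zero
    ((Polynomial.rootMultiplicity_pos hP0).2 hz₀).ne'
  obtain ⟨M, hM, ζ, hζ, hζ0, hroot⟩ := ih ν (by omega) hQa (by rw [hQord, hν])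
  have t1 : Tendsto (fun s : ℂ => s ^ M) (𝓝 0) (𝓝 0) :=
    (continuous_pow M).tendsto' 0 0 (by simp [hM.ne'])
  refine ⟨M * r, Nat.mul_pos hM hr0, fun s => s ^ (M * p) * (z₀ + ζ s) + a (s ^ (M * r)), ?_, ?_, ?_⟩
  · have : AnalyticAt ℂ (fun s : ℂ => a (s ^ (M * r))) 0 :=
      ha.comp_of_eq (f := fun s : ℂ => s ^ (M * r)) (by fun_prop) (by simp [hM.ne', hr0.ne'])
    exact AnalyticAt.add (f := fun s : ℂ => s ^ (M * p) * (z₀ + ζ s)) (by fun_prop) this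
  · simp [hM.ne', hr0.ne', hp0.ne', ha0]
  · have t2 : Tendsto (fun s : ℂ => (s ^ (M * p) * (z₀ + ζ s), s ^ (M * r))) (𝓝 0)
        (𝓝 (0 : ℂ × ℂ)) := by
      have : ContinuousAt (fun s : ℂ => (s ^ (M * p) * (z₀ + ζ s), s ^ (M * r))) 0 := by
        have := hζ.continuousAt
        fun_prop
      have h := this.tendsto
      rwa [show ((0 : ℂ) ^ (M * p) * (z₀ + ζ 0), (0 : ℂ) ^ (M * r)) = 0 by
        simp [hM.ne', hr0.ne', hp0.ne']] at h
    have hEall : ∀ᶠ s in 𝓝 (0 : ℂ), ∀ i ∈ range (n + 2),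
        xCoeff G₂ i ((s ^ M) ^ r) = (s ^ M) ^ (p * (n + 1 - i)) * E i (s ^ M) := by
      rw [Filter.eventually_all_finset]
      exact fun i _ => t1.eventually (hE i)
    filter_upwards [hroot, t2.eventually hTaylor, hEall] with s h1 h2 h3
    have key : G₂ (s ^ (M * p) * (z₀ + ζ s), s ^ (M * r)) =
        (s ^ M) ^ (p * (n + 1)) * Q (ζ s, s ^ M) := by
      rw [h2, hQ]
      simp only [pow_mul s M]
      generalize s ^ M = w at h3
      generalize z₀ + ζ s = Z
      rw [mul_add, Finset.mul_sum]
      congr 1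
      · refine Finset.sum_congr rfl fun i hi => ?_
        have : p * (n + 1) = p * (n + 1 - i) + p * i := by
          rw [← mul_add]; congr 1; simp at hi; omega
        rw [h3 i hi, this, pow_add, mul_pow, pow_mul w p i]
        ring
      · rw [mul_pow]
        ring
    rw [h1, mul_zero] at key
    exact key

/-- **Newton–Puiseux**, factorisation over a common denominator `M`: the roots are split off one
at a time, dividing by `x - η(t)` after `y = t ^ M`. -/
theorem exists_puiseux_factorisation (n : ℕ) : ∀ {G : ℂ × ℂ → ℂ}, AnalyticAt ℂ G 0 →
    analyticOrderAt (fun x => G (x, 0)) 0 = (n : ℕ∞) →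
    ∃ M : ℕ, 0 < M ∧ ∃ η : Fin n → ℂ → ℂ, (∀ i, AnalyticAt ℂ (η i) 0 ∧ η i 0 = 0) ∧
      ∃ V : ℂ × ℂ → ℂ, AnalyticAt ℂ V 0 ∧ V 0 ≠ 0 ∧
        ∀ᶠ v in 𝓝 (0 : ℂ × ℂ), G (v.1, v.2 ^ M) = V v * ∏ i, (v.1 - η i v.2) := by
  induction n with
  | zero =>
    intro G hG hord
    have hGx : AnalyticAt ℂ (fun x : ℂ => G (x, 0)) 0 :=
      hG.comp_of_eq (f := fun x : ℂ => (x, (0 : ℂ))) (by fun_prop) rfl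
    refine ⟨1, one_pos, fun i => i.elim0, fun i => i.elim0, G, hG, ?_, by simp⟩
    exact hGx.analyticOrderAt_eq_zero.1 hord
  | succ n ih =>
    intro G hG hord
    obtain ⟨M, hM, η, hη, hη0, hroot⟩ := exists_puiseux_root n hG hord
    have hη2 : AnalyticAt ℂ (fun v : ℂ × ℂ => η v.2) 0 :=
      hη.comp_of_eq (f := fun v : ℂ × ℂ => v.2) (by fun_prop) rfl
    have hS : AnalyticAt ℂ (fun v : ℂ × ℂ => G (v.1 + η v.2, v.2 ^ M)) 0 :=
      hG.comp_of_eq (f := fun v : ℂ × ℂ => (v.1 + η v.2, v.2 ^ M)) (by fun_prop)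
        (by simp [hη0, hM.ne'])
    obtain ⟨H, hH, hdiv⟩ := hS.exists_eq_add_fst_mul
    have t2 : Tendsto (fun v : ℂ × ℂ => v.2) (𝓝 0) (𝓝 0) := continuous_snd.tendsto' 0 0 rfl
    have hdiv' : ∀ᶠ v in 𝓝 (0 : ℂ × ℂ), G (v.1 + η v.2, v.2 ^ M) = v.1 * H v := by
      filter_upwards [hdiv, t2.eventually hroot] with v h1 h2
      rw [h1, zero_add, h2, zero_add]
    set K : ℂ × ℂ → ℂ := fun v => H (v.1 - η v.2, v.2) with hK
    have hsub : AnalyticAt ℂ (fun v : ℂ × ℂ => (v.1 - η v.2, v.2)) 0 := by fun_prop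
    have hsub0 : (fun v : ℂ × ℂ => (v.1 - η v.2, v.2)) 0 = 0 := by simp [hη0]
    have hKa : AnalyticAt ℂ K 0 := hH.comp_of_eq hsub hsub0
    have hGK : ∀ᶠ v in 𝓝 (0 : ℂ × ℂ), G (v.1, v.2 ^ M) = (v.1 - η v.2) * K v := by
      have t : Tendsto (fun v : ℂ × ℂ => (v.1 - η v.2, v.2)) (𝓝 0) (𝓝 0) := by
        simpa only [ContinuousAt, hsub0] using hsub.continuousAt
      filter_upwards [t.eventually hdiv'] with v hv
      simpa using hv
    have hKord : analyticOrderAt (fun x => K (x, 0)) 0 = (n : ℕ∞) := by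
      have hKx : AnalyticAt ℂ (fun x : ℂ => K (x, 0)) 0 :=
        hKa.comp_of_eq (f := fun x : ℂ => (x, (0 : ℂ))) (by fun_prop) rfl
      have t : Tendsto (fun x : ℂ => (x, (0 : ℂ))) (𝓝 0) (𝓝 0) :=
        (show Continuous (fun x : ℂ => (x, (0 : ℂ))) by fun_prop).tendsto' 0 0 rfl
      have h : (fun x => G (x, 0)) =ᶠ[𝓝 0] fun x => x ^ 1 * K (x, 0) := by
        filter_upwards [t.eventually hGK] with x hx
        simpa [hM.ne', hη0] using hx
      rw [analyticOrderAt_congr h, analyticOrderAt_pow_mul hKx, Nat.cast_add] at hord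
      exact ENat.eq_of_natCast_add_eq (hord.trans (add_comm _ _))
    obtain ⟨M', hM', θ, hθ, V, hV, hV0, hfac⟩ := ih hKa hKord
    refine ⟨M' * M, Nat.mul_pos hM' hM, Fin.cons (fun s => η (s ^ M')) θ, ?_, V, hV, hV0, ?_⟩
    · refine Fin.cases ⟨?_, ?_⟩ hθ
      · exact hη.comp_of_eq (f := fun s : ℂ => s ^ M') (by fun_prop) (by simp [hM'.ne'])
      · simp [hM'.ne', hη0]
    · have t : Tendsto (fun v : ℂ × ℂ => (v.1, v.2 ^ M')) (𝓝 0) (𝓝 0) :=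
        (show Continuous (fun v : ℂ × ℂ => (v.1, v.2 ^ M')) by fun_prop).tendsto' 0 0
          (by simp [hM'.ne'])
      filter_upwards [hfac, t.eventually hGK] with v h1 h2
      rw [Fin.prod_univ_succ, pow_mul, h2, h1]
      simp only [Fin.cons_zero, Fin.cons_succ]
      ring

theorem exists_isPuiseuxFactorisation {G : ℂ × ℂ → ℂ} {n : ℕ} (hG : AnalyticAt ℂ G 0)
    (hord : analyticOrderAt (fun x => G (x, 0)) 0 = (n : ℕ∞)) :
    ∃ η : Fin n → PuiseuxArc, IsPuiseuxFactorisation G η := by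
  obtain ⟨M, hM, η, hη, V, hV, hV0, h⟩ := exists_puiseux_factorisation n hG hord
  refine ⟨fun i => ⟨M, hM, η i, (hη i).1⟩, fun i => (hη i).2, M, hM, fun i => dvd_rfl, V, hV,
    hV0, ?_⟩
  filter_upwards [h] with v hv
  simpa [Nat.div_self hM] using hv

/-! ### Edges of the Newton polygon of a product of linear factors -/

/-- The order of `φ` is read off from the limit of `φ s / s ^ e` at `0`. -/
lemma le_analyticOrderAt_and_eq_iff_of_tendsto {φ : ℂ → ℂ} (hφ : AnalyticAt ℂ φ 0) {e : ℕ} {L : ℂ}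
    (h : Tendsto (fun s => φ s / s ^ e) (𝓝[≠] 0) (𝓝 L)) :
    (e : ℕ∞) ≤ analyticOrderAt φ 0 ∧ (analyticOrderAt φ 0 = e ↔ L ≠ 0) := by
  by_cases hle : (e : ℕ∞) ≤ analyticOrderAt φ 0
  · refine ⟨hle, ?_⟩
    obtain ⟨g, hg, hφg⟩ := (natCast_le_analyticOrderAt_zero hφ).1 hle
    have hL : L = g 0 := by
      refine tendsto_nhds_unique h ((hg.continuousAt.tendsto.mono_left nhdsWithin_le_nhds).congr' ?_)
      filter_upwards [hφg.filter_mono nhdsWithin_le_nhds, self_mem_nhdsWithin] with s h1 h2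
      have : s ≠ 0 := h2
      rw [h1]; field_simp
    rw [analyticOrderAt_congr hφg, analyticOrderAt_pow_mul hg, hL, ← hg.analyticOrderAt_eq_zero]
    constructor
    · intro h; exact ENat.eq_of_natCast_add_eq (k := e) (by rw [h, add_zero])
    · intro h; rw [h, add_zero]
  · exfalso
    rw [not_le] at hle
    obtain ⟨k, hk⟩ := ENat.ne_top_iff_exists.1 (ne_top_of_lt hle)
    rw [← hk, Nat.cast_lt] at hle
    obtain ⟨g, hg, hg0, hφg⟩ := hφ.analyticOrderAt_eq_natCast.1 hk.symm
    have h1 : Tendsto (fun s : ℂ => s ^ (e - k)) (𝓝[≠] 0) (𝓝 0) :=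
      ((continuous_pow (e - k)).tendsto' 0 0 (by simp [Nat.sub_ne_zero_of_lt hle])).mono_left
        nhdsWithin_le_nhds
    have h2 := h1.mul h
    rw [zero_mul] at h2
    refine hg0 (tendsto_nhds_unique
      ((hg.continuousAt.tendsto.mono_left nhdsWithin_le_nhds).congr' ?_) h2)
    filter_upwards [hφg.filter_mono nhdsWithin_le_nhds, self_mem_nhdsWithin] with s h1 h2
    have : s ≠ 0 := h2
    have h3 : s ^ e = s ^ (e - k) * s ^ k := by rw [← pow_add]; congr 1; omega
    rw [h1, h3]
    simp
    field_simp

/-- After the substitution `x = z * s ^ p`, the function `F (x, s)` is divisible by `s ^ e`, and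
the quotient restricts to the nonzero polynomial `P` in `z` at `s = 0`. This encodes the edge of
slope `p` of the Newton polygon of `F`: `e` is the weight of the edge, `P` its polynomial. -/
structure IsEdge (F : ℂ × ℂ → ℂ) (p e : ℕ) (P : Polynomial ℂ) : Prop where
  ne_zero : P ≠ 0
  exists_quotient : ∀ z : ℂ, ∃ R : ℂ → ℂ, AnalyticAt ℂ R 0 ∧ R 0 = P.eval z ∧
    ∀ᶠ s in 𝓝 0, F (z * s ^ p, s) = s ^ e * R s

/-- The edge of a product of linear factors `x - δ i s` is the product of the edges of the factors:
`δ i` contributes `min p (ord δ i)` to the weight, and a root of the edge polynomial if and only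
if `p ≤ ord δ i`. -/
lemma exists_isEdge_of_prod {n : ℕ} {F V : ℂ × ℂ → ℂ} {δ : Fin n → ℂ → ℂ} (hV : AnalyticAt ℂ V 0)
    (hV0 : V 0 ≠ 0) (hδ : ∀ i, AnalyticAt ℂ (δ i) 0)
    (hF : ∀ᶠ v in 𝓝 (0 : ℂ × ℂ), F v = V v * ∏ i, (v.1 - δ i v.2)) {p : ℕ} (hp : 0 < p) :
    ∃ P, IsEdge F p (∑ i, (min (p : ℕ∞) (analyticOrderAt (δ i) 0)).toNat) P ∧
      P.natDegree = Set.ncard {i | (p : ℕ∞) ≤ analyticOrderAt (δ i) 0} := by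
  classical
  set e : Fin n → ℕ := fun i => (min (p : ℕ∞) (analyticOrderAt (δ i) 0)).toNat with he
  have he' : ∀ i, (e i : ℕ∞) = min (p : ℕ∞) (analyticOrderAt (δ i) 0) := fun i =>
    ENat.natCast_toNat (ne_top_of_le_ne_top (ENat.natCast_ne_top p) (min_le_left _ _))
  have hep : ∀ i, e i ≤ p := fun i => by
    have := (he' i).trans_le (min_le_left _ _); exact_mod_cast this
  have hw : ∀ i, ∃ w : ℂ → ℂ, AnalyticAt ℂ w 0 ∧ ∀ᶠ s in 𝓝 0, δ i s = s ^ e i * w s := fun i =>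
    (natCast_le_analyticOrderAt_zero (hδ i)).1 ((he' i).trans_le (min_le_right _ _))
  choose w hwa hw using hw
  have hw0 : ∀ i, ¬ (p : ℕ∞) ≤ analyticOrderAt (δ i) 0 → w i 0 ≠ 0 := by
    intro i hi
    have h := he' i
    rw [min_eq_right (not_le.1 hi).le, analyticOrderAt_congr (hw i),
      analyticOrderAt_pow_mul (hwa i)] at h
    rw [← (hwa i).analyticOrderAt_eq_zero]
    exact (ENat.eq_of_natCast_add_eq (k := e i) (by rw [← h, add_zero]))
  set Q : Fin n → Polynomial ℂ := fun i => if (p : ℕ∞) ≤ analyticOrderAt (δ i) 0 then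
    Polynomial.X - Polynomial.C (w i 0) else Polynomial.C (- w i 0) with hQ
  have hQ0 : ∀ i, Q i ≠ 0 := fun i => by
    by_cases hi : (p : ℕ∞) ≤ analyticOrderAt (δ i) 0
    · simp only [hQ, hi, if_true]; exact Polynomial.X_sub_C_ne_zero _
    · simp only [hQ, hi, if_false]; simpa using hw0 i hi
  have hQe : ∀ i z, (Q i).eval z = z * 0 ^ (p - e i) - w i 0 := by
    intro i z
    by_cases hi : (p : ℕ∞) ≤ analyticOrderAt (δ i) 0
    · have : e i = p := by
        have h := he' i
        rw [min_eq_left hi] at h; exact_mod_cast h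
      simp [hQ, hi, this]
    · have : p - e i ≠ 0 := by
        have h := he' i
        rw [min_eq_right (not_le.1 hi).le] at h
        have h2 := not_le.1 hi
        rw [← h] at h2
        have : e i < p := by exact_mod_cast h2
        omega
      simp [hQ, hi, this]
  refine ⟨Polynomial.C (V 0) * ∏ i, Q i, ⟨?_, fun z => ?_⟩, ?_⟩
  · exact mul_ne_zero (Polynomial.C_ne_zero.2 hV0) (Finset.prod_ne_zero_iff.2 fun i _ => hQ0 i)
  · have hsub : AnalyticAt ℂ (fun s : ℂ => (z * s ^ p, s)) 0 := by fun_prop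
    have hsub0 : (fun s : ℂ => (z * s ^ p, s)) 0 = 0 := by simp [hp.ne']
    have hVs : AnalyticAt ℂ (fun s : ℂ => V (z * s ^ p, s)) 0 := hV.comp_of_eq hsub hsub0
    refine ⟨fun s => V (z * s ^ p, s) * ∏ i, (z * s ^ (p - e i) - w i s), ?_, ?_, ?_⟩
    · refine hVs.mul (Finset.analyticAt_fun_prod _ fun i _ => ?_)
      have := hwa i
      fun_prop
    · simp only [zero_pow hp.ne', mul_zero, Polynomial.eval_mul, Polynomial.eval_C,
        Polynomial.eval_prod, hQe]
      rfl
    · have t : Tendsto (fun s : ℂ => (z * s ^ p, s)) (𝓝 0) (𝓝 0) := by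
        simpa only [ContinuousAt, hsub0] using hsub.continuousAt
      have hall : ∀ᶠ s in 𝓝 (0 : ℂ), ∀ i, δ i s = s ^ e i * w i s := eventually_all.2 hw
      filter_upwards [t.eventually hF, hall] with s h1 h2
      have h3 : ∀ i, z * s ^ p - δ i s = s ^ e i * (z * s ^ (p - e i) - w i s) := by
        intro i
        have : s ^ p = s ^ e i * s ^ (p - e i) := by rw [← pow_add]; congr 1; have := hep i; omega
        rw [h2, this]; ring
      rw [h1]
      simp only [h3, Finset.prod_mul_distrib, Finset.prod_pow_eq_pow_sum]
      ring
  · rw [Polynomial.natDegree_C_mul hV0, Polynomial.natDegree_prod _ _ fun i _ => hQ0 i]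
    have : ∀ i, (Q i).natDegree = if (p : ℕ∞) ≤ analyticOrderAt (δ i) 0 then 1 else 0 := by
      intro i
      by_cases hi : (p : ℕ∞) ≤ analyticOrderAt (δ i) 0
      · simp only [hQ, hi, if_true]; exact Polynomial.natDegree_X_sub_C _
      · simp only [hQ, hi, if_false]; exact Polynomial.natDegree_C _
    simp only [this, Finset.sum_boole, Nat.cast_id]
    rw [← Set.ncard_coe_finset]
    congr 1
    ext i; simp

/-- The polynomials in `z` with coefficients `b j` of degree `< n` converge coefficientwise if they
converge at every point. -/
lemma tendsto_coeff_of_tendsto_eval {l : Filter ℂ} {n : ℕ} {b : Fin n → ℂ → ℂ} {P : Polynomial ℂ}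
    (hP : P.natDegree < n)
    (h : ∀ z, Tendsto (fun s => ∑ j, b j s * z ^ (j : ℕ)) l (𝓝 (P.eval z))) (j : Fin n) :
    Tendsto (b j) l (𝓝 (P.coeff j)) := by
  -- evaluate at the points `0, …, n - 1` and invert the Vandermonde matrix
  set A : Matrix (Fin n) (Fin n) ℂ := Matrix.vandermonde fun k : Fin n => ((k : ℕ) : ℂ) with hA
  have hdet : IsUnit A.det := by
    rw [isUnit_iff_ne_zero, hA, Matrix.det_vandermonde_ne_zero_iff]
    exact fun i j hij => Fin.ext (Nat.cast_injective hij)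
  have hAv : ∀ (v : Fin n → ℂ) (k : Fin n),
      (A.mulVec v) k = ∑ j, v j * ((k : ℕ) : ℂ) ^ (j : ℕ) := by
    intro v k
    simp [hA, Matrix.mulVec, dotProduct, Matrix.vandermonde_apply, mul_comm]
  have h1 : Tendsto (fun s => A.mulVec fun j => b j s) l (𝓝 (A.mulVec fun j => P.coeff j)) := by
    rw [tendsto_pi_nhds]
    intro k
    simp only [hAv]
    have := h ((k : ℕ) : ℂ)
    rwa [Polynomial.eval_eq_sum_range' hP, ← Fin.sum_univ_eq_sum_range
      (fun i => P.coeff i * ((k : ℕ) : ℂ) ^ i)] at this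
  have h2 : Continuous fun v : Fin n → ℂ => A⁻¹.mulVec v := by fun_prop
  have h3 := (h2.tendsto _).comp h1
  simp only [Function.comp_def, Matrix.mulVec_mulVec, Matrix.nonsing_inv_mul A hdet,
    Matrix.one_mulVec] at h3
  exact (tendsto_pi_nhds.1 h3) j

namespace IsEdge

variable {F : ℂ × ℂ → ℂ} {p e : ℕ} {P : Polynomial ℂ}

/-- The Taylor coefficients of `F` in `x` lie on or above the edge, and those on the edge are the
ones which occur in the edge polynomial. -/
lemma le_order_xCoeff (h : IsEdge F p e P) (hF : AnalyticAt ℂ F 0) (hp : 0 < p) (i : ℕ) :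
    (e : ℕ∞) ≤ ((p * i : ℕ) : ℕ∞) + analyticOrderAt (xCoeff F i) 0 ∧
      (((p * i : ℕ) : ℕ∞) + analyticOrderAt (xCoeff F i) 0 = e ↔ P.coeff i ≠ 0) := by
  -- large enough for the remainder `x ^ n * H` to be negligible against `s ^ e`
  set n := e + P.natDegree + i + 1 with hn
  obtain ⟨H, hH, hT⟩ := hF.exists_taylor_fst n
  have key : ∀ z, Tendsto (fun s => ∑ j : Fin n, (s ^ (p * j) * xCoeff F j s / s ^ e) * z ^ (j : ℕ))
      (𝓝[≠] 0) (𝓝 (P.eval z)) := by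
    intro z
    obtain ⟨R, hR, hR0, hFR⟩ := h.exists_quotient z
    have hsub : AnalyticAt ℂ (fun s : ℂ => (z * s ^ p, s)) 0 := by fun_prop
    have hsub0 : (fun s : ℂ => (z * s ^ p, s)) 0 = 0 := by simp [hp.ne']
    have hHs : AnalyticAt ℂ (fun s : ℂ => H (z * s ^ p, s)) 0 := hH.comp_of_eq hsub hsub0
    have t : Tendsto (fun s : ℂ => (z * s ^ p, s)) (𝓝 0) (𝓝 0) := by
      simpa only [ContinuousAt, hsub0] using hsub.continuousAt
    have hlt : e < p * n := lt_of_lt_of_le (by omega) (Nat.le_mul_of_pos_left n hp)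
    have hlim : Tendsto (fun s => R s - s ^ (p * n - e) * (z ^ n * H (z * s ^ p, s))) (𝓝[≠] 0)
        (𝓝 (P.eval z)) := by
      have hc : ContinuousAt (fun s => R s - s ^ (p * n - e) * (z ^ n * H (z * s ^ p, s))) 0 := by
        have h1 := hR.continuousAt
        have h2 := hHs.continuousAt
        exact h1.sub ((continuous_pow _).continuousAt.mul (continuousAt_const.mul h2))
      have h0 : (0 : ℂ) ^ (p * n - e) = 0 := zero_pow (by omega)
      have := hc.tendsto.mono_left (nhdsWithin_le_nhds (s := {0}ᶜ))
      simpa only [h0, zero_mul, sub_zero, hR0] using this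
    refine hlim.congr' ?_
    filter_upwards [hFR.filter_mono nhdsWithin_le_nhds,
      (t.eventually hT).filter_mono nhdsWithin_le_nhds, self_mem_nhdsWithin] with s h1 h2 h3
    have hs : s ≠ 0 := h3
    have hse : s ^ e ≠ 0 := pow_ne_zero _ hs
    have h4 : s ^ (p * n) = s ^ e * s ^ (p * n - e) := by rw [← pow_add]; congr 1; omega
    rw [h1] at h2
    have h5 : ∑ j : Fin n, (s ^ (p * j) * xCoeff F j s / s ^ e) * z ^ (j : ℕ) =
        (∑ j ∈ range n, xCoeff F j s * (z * s ^ p) ^ j) / s ^ e := by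
      rw [Fin.sum_univ_eq_sum_range (fun j => (s ^ (p * j) * xCoeff F j s / s ^ e) * z ^ j),
        Finset.sum_div]
      refine Finset.sum_congr rfl fun j _ => ?_
      rw [mul_pow, ← pow_mul]; ring
    rw [h5, eq_div_iff hse]
    rw [mul_pow z, ← pow_mul, h4] at h2
    linear_combination h2
  have hlim := tendsto_coeff_of_tendsto_eval (by omega) key ⟨i, by omega⟩
  have hc := hF.xCoeff i
  have := le_analyticOrderAt_and_eq_iff_of_tendsto (φ := fun s => s ^ (p * i) * xCoeff F i s)
    (by fun_prop) hlim
  rwa [analyticOrderAt_pow_mul hc] at this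

/-- Off the roots of the edge polynomial, `e` is the order of `F (u * s ^ p, s)`. -/
lemma eventually_order_eq (h : IsEdge F p e P) :
    ∀ᶠ u : ℂ in cofinite, analyticOrderAt (fun s => F (u * s ^ p, s)) 0 = e := by
  have hfin : {u : ℂ | P.eval u = 0}.Finite := by
    refine (P.roots.toFinset.finite_toSet).subset fun u hu => ?_
    simpa [h.ne_zero] using hu
  filter_upwards [hfin.compl_mem_cofinite] with u hu
  obtain ⟨R, hR, hR0, hFR⟩ := h.exists_quotient u
  rw [analyticOrderAt_congr hFR, analyticOrderAt_pow_mul hR, hR.analyticOrderAt_eq_zero.2, add_zero]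
  rw [hR0]; exact hu

end IsEdge

lemma le_analyticOrderAt_sum {ι : Type*} (S : Finset ι) {f : ι → ℂ → ℂ} {k : ℕ∞}
    (h : ∀ i ∈ S, k ≤ analyticOrderAt (f i) 0) :
    k ≤ analyticOrderAt (fun s => ∑ i ∈ S, f i s) 0 := by
  classical
  induction S using Finset.induction_on with
  | empty =>
    have : analyticOrderAt (fun _ : ℂ => (0 : ℂ)) 0 = ⊤ := analyticOrderAt_eq_top.2 (by simp)
    simp [this]
  | insert a S ha ih =>
    simp only [Finset.sum_insert ha]
    refine le_trans (le_min (h a (by simp)) (ih fun i hi => h i (by simp [hi]))) ?_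
    exact le_analyticOrderAt_add

/-- If `∂F/∂x` has weight `e` along the edge of slope `p`, then an increment `X` of order `≥ p`
changes `F` by terms of order `≥ e + p`. -/
lemma IsEdge.le_order_increment {F : ℂ × ℂ → ℂ} {p e : ℕ} {P : Polynomial ℂ}
    (h : IsEdge (partialX F) p e P) (hF : AnalyticAt ℂ F 0) (hp : 0 < p) {X : ℂ → ℂ}
    (hX : AnalyticAt ℂ X 0) (hXp : (p : ℕ∞) ≤ analyticOrderAt X 0) :
    ((e + p : ℕ) : ℕ∞) ≤ analyticOrderAt (fun s => F (X s, s) - F (0, s)) 0 := by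
  obtain ⟨H, hH, hT⟩ := hF.exists_taylor_fst (e + p + 1)
  have hX0 : X 0 = 0 := by
    refine apply_eq_zero_of_analyticOrderAt_ne_zero (ne_of_gt (lt_of_lt_of_le ?_ hXp))
    exact_mod_cast hp
  have hsub : AnalyticAt ℂ (fun s : ℂ => (X s, s)) 0 := by fun_prop
  have hsub0 : (fun s : ℂ => (X s, s)) 0 = 0 := by simp [hX0]
  have hHs : AnalyticAt ℂ (fun s : ℂ => H (X s, s)) 0 := hH.comp_of_eq hsub hsub0
  have t : Tendsto (fun s : ℂ => (X s, s)) (𝓝 0) (𝓝 0) := by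
    simpa only [ContinuousAt, hsub0] using hsub.continuousAt
  have t0 : Tendsto (fun s : ℂ => ((0 : ℂ), s)) (𝓝 0) (𝓝 0) :=
    (show Continuous (fun s : ℂ => ((0 : ℂ), s)) by fun_prop).tendsto' 0 0 rfl
  have hev : (fun s => F (X s, s) - F (0, s)) =ᶠ[𝓝 0]
      fun s => (∑ j ∈ range (e + p), xCoeff F (j + 1) s * X s ^ (j + 1)) +
        X s ^ (e + p + 1) * H (X s, s) := by
    filter_upwards [t.eventually hT, t0.eventually hT] with s h1 h2
    rw [h1, h2, Finset.sum_range_succ', Finset.sum_range_succ' (fun i => _ * (0 : ℂ) ^ i)]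
    simp
    ring
  have hXpow : ∀ k : ℕ, ((k * p : ℕ) : ℕ∞) ≤ analyticOrderAt (fun s => X s ^ k) 0 := by
    intro k
    have := analyticOrderAt_pow hX k
    simp only [Pi.pow_def] at this
    rw [this, nsmul_eq_mul, Nat.cast_mul]
    gcongr
  rw [analyticOrderAt_congr hev]
  refine le_trans (le_min (le_analyticOrderAt_sum _ fun j _ => ?_) ?_) le_analyticOrderAt_add
  · have hc := hF.xCoeff (j + 1)
    have h1 := analyticOrderAt_mul hc (hX.pow (j + 1))
    have h2 := (h.le_order_xCoeff hF.partialX hp j).1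
    have h3 : analyticOrderAt (xCoeff (partialX F) j) 0 = analyticOrderAt (xCoeff F (j + 1)) 0 := by
      have hj : ((j : ℂ) + 1) ≠ 0 := by exact_mod_cast j.succ_ne_zero
      have h4 := analyticOrderAt_mul (f := fun _ => ((j : ℂ) + 1)) (z₀ := 0) analyticAt_const hc
      rw [(analyticAt_const.analyticOrderAt_eq_zero).2 hj, zero_add] at h4
      rw [← h4]
      exact analyticOrderAt_congr (Eventually.of_forall fun y => xCoeff_partialX F j y)
    rw [h3] at h2
    change _ ≤ analyticOrderAt (xCoeff F (j + 1) * X ^ (j + 1)) 0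
    rw [h1]
    calc ((e + p : ℕ) : ℕ∞) ≤ (((p * j : ℕ) : ℕ∞) + analyticOrderAt (xCoeff F (j + 1)) 0) + p := by
          rw [Nat.cast_add]; gcongr
      _ = analyticOrderAt (xCoeff F (j + 1)) 0 + (((j + 1) * p : ℕ) : ℕ∞) := by
          push_cast; ring
      _ ≤ _ := by gcongr; exact hXpow (j + 1)
  · have h1 := analyticOrderAt_mul (hX.pow (e + p + 1)) hHs
    change _ ≤ analyticOrderAt (X ^ (e + p + 1) * fun s => H (X s, s)) 0
    rw [h1]
    refine le_trans (le_trans ?_ (hXpow (e + p + 1))) le_self_add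
    have : e + p ≤ (e + p + 1) * p := by nlinarith
    exact_mod_cast this

/-! ### Puiseux arcs and their orders -/

lemma fracOrder_eq_top {N : ℕ} {φ : ℂ → ℂ} : fracOrder N φ = ⊤ ↔ analyticOrderAt φ 0 = ⊤ := by
  unfold fracOrder
  cases analyticOrderAt φ 0 <;> simp

lemma fracOrder_congr {N : ℕ} {φ ψ : ℂ → ℂ} (h : φ =ᶠ[𝓝 0] ψ) : fracOrder N φ = fracOrder N ψ := by
  rw [fracOrder, fracOrder, analyticOrderAt_congr h]

lemma fracOrder_eq_div_iff {N : ℕ} (hN : 0 < N) {φ : ℂ → ℂ} {k : ℕ} :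
    fracOrder N φ = (((k : ℚ) / N : ℚ) : WithTop ℚ) ↔ analyticOrderAt φ 0 = k := by
  have hN' : (N : ℚ) ≠ 0 := by exact_mod_cast hN.ne'
  unfold fracOrder
  cases h : analyticOrderAt φ 0 with
  | top => simp
  | coe a =>
    simp [div_left_inj' hN']

lemma div_le_fracOrder_iff {N : ℕ} (hN : 0 < N) {φ : ℂ → ℂ} {k : ℕ} :
    (((k : ℚ) / N : ℚ) : WithTop ℚ) ≤ fracOrder N φ ↔ (k : ℕ∞) ≤ analyticOrderAt φ 0 := by
  have hN' : (0 : ℚ) < N := by exact_mod_cast hN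
  unfold fracOrder
  cases h : analyticOrderAt φ 0 with
  | top => simp
  | coe a =>
    simp [div_le_div_iff_of_pos_right hN']

/-- Fractional orders do not depend on the parametrisation. -/
lemma fracOrder_comp_pow {N k : ℕ} (hk : 0 < k) {φ : ℂ → ℂ} (hφ : AnalyticAt ℂ φ 0) :
    fracOrder (N * k) (fun s => φ (s ^ k)) = fracOrder N φ := by
  have hk' : (k : ℚ) ≠ 0 := by exact_mod_cast hk.ne'
  unfold fracOrder
  rw [analyticOrderAt_comp_pow hφ hk]
  cases h : analyticOrderAt φ 0 with
  | top => rw [ENat.mul_top (by exact_mod_cast hk.ne')]; simp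
  | coe a =>
    rw [← Nat.cast_mul, ENat.map_natCast, ENat.map_natCast]
    congr 1
    push_cast
    field_simp

lemma toNat_min_div_eq_untopD {L p : ℕ} (hL : 0 < L) (φ : ℂ → ℂ) :
    ((min (p : ℕ∞) (analyticOrderAt φ 0)).toNat : ℚ) / L =
      (min ((((p : ℚ) / L : ℚ)) : WithTop ℚ) (fracOrder L φ)).untopD 0 := by
  by_cases h : (p : ℕ∞) ≤ analyticOrderAt φ 0
  · rw [min_eq_left h, min_eq_left ((div_le_fracOrder_iff hL).2 h)]
    simp
  · rw [min_eq_right (not_le.1 h).le,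
      min_eq_right (not_le.1 (mt (div_le_fracOrder_iff hL).1 h)).le]
    obtain ⟨a, ha⟩ := ENat.ne_top_iff_exists.1 (ne_top_of_lt (not_le.1 h))
    rw [(fracOrder_eq_div_iff hL).2 ha.symm, ← ha]
    simp

lemma taylorCoeff_eq (G : ℂ × ℂ → ℂ) (i k : ℕ) :
    taylorCoeff G i k = iteratedDeriv k (xCoeff G i) 0 / (k.factorial : ℂ) := by
  have : iteratedDeriv k (xCoeff G i) 0 =
      iteratedDeriv k (fun T => iteratedDeriv i (fun X => G (X, T)) 0) 0 / (i.factorial : ℂ) := by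
    change iteratedDeriv k (fun y => iteratedDeriv i (fun x => G (x, y)) 0 / (i.factorial : ℂ)) 0 = _
    simp only [iteratedDeriv_div_const]
  rw [this, taylorCoeff, div_div]

lemma order_xCoeff_le_of_taylorCoeff_ne_zero {G : ℂ × ℂ → ℂ} (hG : AnalyticAt ℂ G 0) {i k : ℕ}
    (h : taylorCoeff G i k ≠ 0) : analyticOrderAt (xCoeff G i) 0 ≤ k := by
  by_contra! hlt
  have h1 : ((k + 1 : ℕ) : ℕ∞) ≤ analyticOrderAt (xCoeff G i) 0 := by
    rw [Nat.cast_add]; exact Order.add_one_le_of_lt hlt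
  rw [natCast_le_analyticOrderAt_iff_iteratedDeriv_eq_zero (hG.xCoeff i)] at h1
  exact h (by rw [taylorCoeff_eq, h1 k k.lt_succ_self, zero_div])

lemma taylorCoeff_ne_zero_of_order_xCoeff_eq {G : ℂ × ℂ → ℂ} (hG : AnalyticAt ℂ G 0) {i k : ℕ}
    (h : analyticOrderAt (xCoeff G i) 0 = k) : taylorCoeff G i k ≠ 0 := by
  rw [analyticOrderAt_eq_nat_iff_iteratedDeriv_eq_zero (hG.xCoeff i)] at h
  rw [taylorCoeff_eq]
  exact div_ne_zero h.2 (by exact_mod_cast k.factorial_ne_zero)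

lemma le_order_xCoeff_of_taylorCoeff_eq_zero {G : ℂ × ℂ → ℂ} (hG : AnalyticAt ℂ G 0) {i n : ℕ}
    (h : ∀ k < n, taylorCoeff G i k = 0) : (n : ℕ∞) ≤ analyticOrderAt (xCoeff G i) 0 := by
  rw [natCast_le_analyticOrderAt_iff_iteratedDeriv_eq_zero (hG.xCoeff i)]
  intro k hk
  have := h k hk
  rw [taylorCoeff_eq, div_eq_zero_iff] at this
  exact this.resolve_right (by exact_mod_cast k.factorial_ne_zero)

namespace PuiseuxArc

/-- The germ representing the series `α(y)` in the parameter `s` with `y = s ^ L`, for a multiple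
`L` of the denominator of `α`. -/
def lift (α : PuiseuxArc) (L : ℕ) (s : ℂ) : ℂ := α.toFun (s ^ (L / α.denom))

lemma lift_zero {α : PuiseuxArc} {L : ℕ} (hL : 0 < L) (h : α.denom ∣ L) :
    α.lift L 0 = α.toFun 0 := by
  have : 0 < L / α.denom := Nat.div_pos (Nat.le_of_dvd hL h) α.denom_pos
  simp [lift, this.ne']

lemma analyticAt_lift {α : PuiseuxArc} {L : ℕ} (hL : 0 < L) (h : α.denom ∣ L) :
    AnalyticAt ℂ (α.lift L) 0 := by
  have : 0 < L / α.denom := Nat.div_pos (Nat.le_of_dvd hL h) α.denom_pos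
  exact α.analytic.comp_of_eq (f := fun s : ℂ => s ^ (L / α.denom)) (by fun_prop)
    (by simp [this.ne'])

lemma fracOrder_lift {α : PuiseuxArc} {L : ℕ} (hL : 0 < L) (h : α.denom ∣ L) :
    fracOrder L (α.lift L) = α.order := by
  obtain ⟨k, rfl⟩ := h
  have hk : 0 < k := Nat.pos_of_mul_pos_left hL
  have := fracOrder_comp_pow (N := α.denom) hk α.analytic
  rw [order, ← this]
  congr 1
  ext1 s
  simp only [lift, Nat.mul_div_cancel_left _ α.denom_pos]

lemma fracOrder_lift_along {α : PuiseuxArc} {L : ℕ} (hL : 0 < L) (h : α.denom ∣ L)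
    {G : ℂ × ℂ → ℂ} (hG : AnalyticAt ℂ G 0) (h0 : α.toFun 0 = 0) :
    fracOrder L (fun s => G (α.lift L s, s ^ L)) = α.orderAlong G := by
  obtain ⟨k, rfl⟩ := h
  have hk : 0 < k := Nat.pos_of_mul_pos_left hL
  have hα := α.analytic
  have hφ : AnalyticAt ℂ (fun t => G (α.toFun t, t ^ α.denom)) 0 :=
    hG.comp_of_eq (f := fun t : ℂ => (α.toFun t, t ^ α.denom)) (by fun_prop)
      (by simp [h0, α.denom_pos.ne'])
  have := fracOrder_comp_pow (N := α.denom) hk hφ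
  rw [orderAlong, ← this]
  simp only [lift, Nat.mul_div_cancel_left _ α.denom_pos, ← pow_mul, mul_comm k]

lemma fracOrder_lift_sub_lift {α β : PuiseuxArc} {L : ℕ} (hL : 0 < L)
    (h : α.denom * β.denom ∣ L) :
    fracOrder L (fun s => α.lift L s - β.lift L s) = (α.sub β).order := by
  obtain ⟨k, rfl⟩ := h
  have hk : 0 < k := Nat.pos_of_mul_pos_left hL
  have := fracOrder_comp_pow (N := α.denom * β.denom) hk (α.sub β).analytic
  rw [order]
  change _ = fracOrder (α.denom * β.denom) _
  rw [← this]
  have h1 : α.denom * β.denom * k / α.denom = k * β.denom := by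
    rw [mul_assoc, Nat.mul_div_cancel_left _ α.denom_pos, mul_comm]
  have h2 : α.denom * β.denom * k / β.denom = k * α.denom := by
    rw [mul_comm α.denom, mul_assoc, Nat.mul_div_cancel_left _ β.denom_pos, mul_comm]
  simp only [lift, h1, h2, sub, ← pow_mul]

lemma lift_addMonomial {γ : PuiseuxArc} {q : ℚ} (hq : 0 ≤ q) (u : ℂ) {L p : ℕ} (hL : 0 < L)
    (h : γ.denom * q.den ∣ L) (hp : (p : ℚ) = q * L) (s : ℂ) :
    (γ.addMonomial u q).lift L s = γ.lift L s + u * s ^ p := by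
  obtain ⟨k, rfl⟩ := h
  have h1 : γ.denom * q.den * k / γ.denom = k * q.den := by
    rw [mul_assoc, Nat.mul_div_cancel_left _ γ.denom_pos, mul_comm]
  have h2 : γ.denom * q.den * k / (γ.denom * q.den) = k :=
    Nat.mul_div_cancel_left _ (Nat.mul_pos γ.denom_pos q.den_pos)
  have h3 : p = k * (γ.denom * q.num.toNat) := by
    have hnum : ((q.num.toNat : ℕ) : ℚ) = q.num := by
      exact_mod_cast Int.toNat_of_nonneg (Rat.num_nonneg.2 hq)
    have : (p : ℚ) = ((k * (γ.denom * q.num.toNat) : ℕ) : ℚ) := by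
      rw [hp]; push_cast
      rw [hnum, ← Rat.mul_den_eq_num q]; ring
    exact_mod_cast this
  simp only [lift, addMonomial, h1, h2, h3, ← pow_mul]

lemma addMonomial_apply_zero {γ : PuiseuxArc} (h0 : γ.toFun 0 = 0) (u : ℂ) {q : ℚ} (hq : 0 < q) :
    (γ.addMonomial u q).toFun 0 = 0 := by
  have h1 : 0 < q.num.toNat := by
    have := Rat.num_pos.2 hq
    omega
  simp [addMonomial, h0, q.den_pos.ne', γ.denom_pos.ne', h1.ne']

/-- The germ `F (X, s) = G (X + γ(y), y)`, `y = s ^ L`. -/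
def translate (γ : PuiseuxArc) (G : ℂ × ℂ → ℂ) (L : ℕ) : ℂ × ℂ → ℂ :=
  fun v => G (v.1 + γ.lift L v.2, v.2 ^ L)

lemma analyticAt_translate {γ : PuiseuxArc} {G : ℂ × ℂ → ℂ} {L : ℕ} (hL : 0 < L)
    (h : γ.denom ∣ L) (hG : AnalyticAt ℂ G 0) (h0 : γ.toFun 0 = 0) :
    AnalyticAt ℂ (γ.translate G L) 0 := by
  have h1 : AnalyticAt ℂ (fun v : ℂ × ℂ => γ.lift L v.2) 0 :=
    (analyticAt_lift hL h).comp_of_eq (f := fun v : ℂ × ℂ => v.2) (by fun_prop) rfl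
  exact hG.comp_of_eq (f := fun v : ℂ × ℂ => (v.1 + γ.lift L v.2, v.2 ^ L)) (by fun_prop)
    (by simp [lift_zero hL h, h0, hL.ne'])

lemma partialX_translate (γ : PuiseuxArc) (f : ℂ × ℂ → ℂ) (L : ℕ) :
    partialX (γ.translate f L) = γ.translate (partialX f) L := by
  ext1 v
  exact deriv_comp_add_const (fun x => f (x, v.2 ^ L)) (γ.lift L v.2) v.1

lemma translate_self (γ : PuiseuxArc) (G : ℂ × ℂ → ℂ) :
    γ.translate G γ.denom = fun v => G (v.1 + γ.toFun v.2, v.2 ^ γ.denom) := by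
  ext1 v
  simp [translate, lift, Nat.div_self γ.denom_pos]

lemma xCoeff_translate (γ : PuiseuxArc) (G : ℂ × ℂ → ℂ) (k i : ℕ) (s : ℂ) :
    xCoeff (γ.translate G (γ.denom * k)) i s = xCoeff (γ.translate G γ.denom) i (s ^ k) := by
  simp only [xCoeff, translate, lift, Nat.mul_div_cancel_left _ γ.denom_pos,
    Nat.div_self γ.denom_pos, pow_one, ← pow_mul, mul_comm k]

end PuiseuxArc

/-- The sum `∑ i, min q (ord (η i - γ))`: the order of `∏ i, (x - η i)` along a generic arc
`γ(y) + u * y ^ q`. -/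
noncomputable def contactSum {n : ℕ} (η : Fin n → PuiseuxArc) (γ : PuiseuxArc) (q : ℚ) : ℚ :=
  ∑ i, (min (q : WithTop ℚ) ((η i).sub γ).order).untopD 0

/-- Edges of a germ with a Puiseux factorisation, relative to an arbitrary arc `γ`. The slope is
`p / L`, for any common denominator `L` divisible enough. -/
lemma IsPuiseuxFactorisation.exists_isEdge {G : ℂ × ℂ → ℂ} {n : ℕ} {η : Fin n → PuiseuxArc}
    (h : IsPuiseuxFactorisation G η) :
    ∃ M : ℕ, 0 < M ∧ ∀ γ : PuiseuxArc, γ.toFun 0 = 0 → ∀ L p : ℕ, 0 < L → 0 < p →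
      M * γ.denom ∣ L → ∃ (e : ℕ) (P : Polynomial ℂ), IsEdge (γ.translate G L) p e P ∧
        (e : ℚ) / L = contactSum η γ ((p : ℚ) / L) ∧
        P.natDegree =
          Set.ncard {i | (((p : ℚ) / L : ℚ) : WithTop ℚ) ≤ ((η i).sub γ).order} := by
  obtain ⟨-, M, hM, hdvd, V, hV, hV0, hfac⟩ := h
  refine ⟨M, hM, fun γ h0 L p hL hp hdL => ?_⟩
  have hML : M ∣ L := (Dvd.intro _ rfl).trans hdL
  have hNL : γ.denom ∣ L := (Dvd.intro_left _ rfl).trans hdL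
  have hηL : ∀ i, (η i).denom * γ.denom ∣ L := fun i => (Nat.mul_dvd_mul_right (hdvd i) _).trans hdL
  have hηL' : ∀ i, (η i).denom ∣ L := fun i => (hdvd i).trans hML
  have hk : 0 < L / M := Nat.div_pos (Nat.le_of_dvd hL hML) hM
  have hγ := PuiseuxArc.analyticAt_lift hL hNL
  have hγ2 : AnalyticAt ℂ (fun v : ℂ × ℂ => γ.lift L v.2) 0 :=
    hγ.comp_of_eq (f := fun v : ℂ × ℂ => v.2) (by fun_prop) rfl
  have hsub : AnalyticAt ℂ (fun v : ℂ × ℂ => (v.1 + γ.lift L v.2, v.2 ^ (L / M))) 0 := by fun_prop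
  have hsub0 : (fun v : ℂ × ℂ => (v.1 + γ.lift L v.2, v.2 ^ (L / M))) 0 = 0 := by
    simp [PuiseuxArc.lift_zero hL hNL, h0, hk.ne']
  have t : Tendsto (fun v : ℂ × ℂ => (v.1 + γ.lift L v.2, v.2 ^ (L / M))) (𝓝 0) (𝓝 0) := by
    simpa only [ContinuousAt, hsub0] using hsub.continuousAt
  have hF : ∀ᶠ v in 𝓝 (0 : ℂ × ℂ), γ.translate G L v =
      V (v.1 + γ.lift L v.2, v.2 ^ (L / M)) *
        ∏ i, (v.1 - ((η i).lift L v.2 - γ.lift L v.2)) := by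
    filter_upwards [t.eventually hfac] with v hv
    simp only [← pow_mul, Nat.div_mul_cancel hML] at hv
    rw [PuiseuxArc.translate, hv]
    congr 1
    refine Finset.prod_congr rfl fun i _ => ?_
    have : L / M * (M / (η i).denom) = L / (η i).denom := by
      obtain ⟨a, ha⟩ := hdvd i
      obtain ⟨b, hb⟩ := hML
      rw [hb, Nat.mul_div_cancel_left _ hM, ha, Nat.mul_div_cancel_left _ (η i).denom_pos,
        mul_assoc, Nat.mul_div_cancel_left _ (η i).denom_pos, mul_comm]
    rw [this]
    simp only [PuiseuxArc.lift]
    ring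
  obtain ⟨P, hP, hdeg⟩ := exists_isEdge_of_prod
    (δ := fun i s => (η i).lift L s - γ.lift L s) (hV.comp_of_eq hsub hsub0)
    (by change V ((fun v : ℂ × ℂ => (v.1 + γ.lift L v.2, v.2 ^ (L / M))) 0) ≠ 0; rwa [hsub0])
    (fun i => (PuiseuxArc.analyticAt_lift hL (hηL' i)).sub hγ) hF hp
  refine ⟨_, P, hP, ?_, ?_⟩
  · rw [contactSum, Nat.cast_sum, Finset.sum_div]
    refine Finset.sum_congr rfl fun i _ => ?_
    rw [toNat_min_div_eq_untopD hL, PuiseuxArc.fracOrder_lift_sub_lift hL (hηL i)]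
  · rw [hdeg]
    congr 1
    ext i
    rw [Set.mem_ofPred_eq, Set.mem_ofPred_eq, ← div_le_fracOrder_iff hL,
      PuiseuxArc.fracOrder_lift_sub_lift hL (hηL i)]

/-! ### Top compact edge of a convex hull -/

/-- The points of `convexHull ℝ (U ∪ {(0, b)})` where `U` lies in `{1 ≤ x}`, lies above the line
`d * x + y = b`, and meets this line only at abscissae `≤ c`. -/
lemma convexHull_union_subset {U : Set (ℝ × ℝ)} {d b c : ℝ} (hc : 0 ≤ c)
    (hU : ∀ u ∈ U, 1 ≤ u.1 ∧ (b < d * u.1 + u.2 ∨ d * u.1 + u.2 = b ∧ u.1 ≤ c)) :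
    ∀ u ∈ convexHull ℝ (U ∪ {((0 : ℝ), b)}),
      0 ≤ u.1 ∧ (u.1 = 0 → u.2 = b) ∧ (b < d * u.1 + u.2 ∨ d * u.1 + u.2 = b ∧ u.1 ≤ c) := by
  set K : Set (ℝ × ℝ) := {u | 0 ≤ u.1 ∧ (u.1 = 0 → u.2 = b) ∧
    (b < d * u.1 + u.2 ∨ d * u.1 + u.2 = b ∧ u.1 ≤ c)} with hK
  have hconv : Convex ℝ K := by
    rw [convex_iff_forall_pos]
    rintro u ⟨hu1, hu2, hu3⟩ v ⟨hv1, hv2, hv3⟩ α β hα hβ hαβ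
    have e1 : (α • u + β • v).1 = α * u.1 + β * v.1 := rfl
    have e2 : (α • u + β • v).2 = α * u.2 + β * v.2 := rfl
    have hβ' : β = 1 - α := by linarith
    have e3 : d * (α * u.1 + β * v.1) + (α * u.2 + β * v.2) - b =
        α * (d * u.1 + u.2 - b) + β * (d * v.1 + v.2 - b) := by rw [hβ']; ring
    refine ⟨?_, ?_, ?_⟩
    · rw [e1]; positivity
    · rw [e1, e2]
      intro h
      have h1 : α * u.1 = 0 := by nlinarith [mul_nonneg hα.le hu1, mul_nonneg hβ.le hv1]
      have h2 : β * v.1 = 0 := by nlinarith [mul_nonneg hα.le hu1, mul_nonneg hβ.le hv1]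
      rw [hu2 ((mul_eq_zero.1 h1).resolve_left hα.ne'),
        hv2 ((mul_eq_zero.1 h2).resolve_left hβ.ne'), hβ']
      ring
    · rw [e1, e2]
      rcases hu3 with hu3 | ⟨hu3, hu4⟩
      · left
        have := mul_pos hα (sub_pos.2 hu3)
        have h4 : 0 ≤ d * v.1 + v.2 - b := by
          rcases hv3 with h | h
          · linarith
          · linarith [h.1]
        have := mul_nonneg hβ.le h4
        linarith
      · rcases hv3 with hv3 | ⟨hv3, hv4⟩
        · left
          have := mul_pos hβ (sub_pos.2 hv3)
          rw [hu3, sub_self, mul_zero] at e3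
          linarith
        · right
          rw [hu3, hv3, sub_self, mul_zero, mul_zero] at e3
          refine ⟨by linarith, ?_⟩
          have := mul_le_mul_of_nonneg_left hu4 hα.le
          have := mul_le_mul_of_nonneg_left hv4 hβ.le
          have : α * c + β * c = c := by rw [hβ']; ring
          linarith
  have hsub : U ∪ {((0 : ℝ), b)} ⊆ K := by
    rintro u (hu | rfl)
    · obtain ⟨h1, h2⟩ := hU u hu
      exact ⟨by linarith, fun h => by linarith, h2⟩
    · exact ⟨le_rfl, fun _ => rfl, Or.inr ⟨by simp, hc⟩⟩
  exact convexHull_min hsub hconv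

/-- The top compact edge of the convex hull of `(0, b)` and of an upward closed region `U` to the
right of the vertical axis, when the supporting line of slope `-d` through `(0, b)` meets `U` last
at abscissa `c`. -/
lemma topCompactEdge_of_supporting_line {U : Set (ℝ × ℝ)} {d b c : ℝ} (hc : 0 < c)
    (hU : ∀ u ∈ U, 1 ≤ u.1 ∧ (b < d * u.1 + u.2 ∨ d * u.1 + u.2 = b ∧ u.1 ≤ c))
    (hcU : (c, b - d * c) ∈ U)
    (hup : ∀ u ∈ U, ∀ s t : ℝ, 0 ≤ s → 0 ≤ t → (u.1 + s, u.2 + t) ∈ U) :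
    (∃ p q, IsTopCompactEdge (convexHull ℝ (U ∪ {((0 : ℝ), b)})) p q) ∧
      ∀ p q, IsTopCompactEdge (convexHull ℝ (U ∪ {((0 : ℝ), b)})) p q → q.1 - p.1 = c := by
  set A := convexHull ℝ (U ∪ {((0 : ℝ), b)}) with hA
  have hbA : ((0 : ℝ), b) ∈ A := subset_convexHull ℝ _ (Or.inr rfl)
  have hUA : U ⊆ A := fun u hu => subset_convexHull ℝ _ (Or.inl hu)
  have hA' := convexHull_union_subset hc.le hU
  have hseg : ∀ u ∈ segment ℝ ((0 : ℝ), b) (c, b - d * c), u ∈ A := fun u hu =>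
    (convex_convexHull ℝ _).segment_subset hbA (hUA hcU) hu
  have hedge : IsCompactEdge A ((0 : ℝ), b) (c, b - d * c) := by
    refine ⟨hc, fun _ => ⟨-(d • ContinuousLinearMap.fst ℝ ℝ ℝ + ContinuousLinearMap.snd ℝ ℝ ℝ), ?_⟩⟩
    ext u
    simp only [Set.mem_ofPred_eq, neg_apply, add_apply,
      smul_apply, ContinuousLinearMap.coe_fst', ContinuousLinearMap.coe_snd',
      smul_eq_mul, neg_le_neg_iff]
    constructor
    · intro hu
      refine ⟨hseg u hu, fun v hv => ?_⟩
      have h1 : d * u.1 + u.2 = b := by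
        obtain ⟨α, β, hα, hβ, hαβ, rfl⟩ := hu
        simp
        have : α = 1 - β := by linarith
        rw [this]; ring
      rcases (hA' v hv).2.2 with h | h
      · linarith
      · linarith [h.1]
    · rintro ⟨hu, hmin⟩
      have h1 := hmin _ hbA
      simp only [mul_zero, zero_add] at h1
      obtain ⟨h2, -, h3⟩ := hA' u hu
      rcases h3 with h3 | ⟨h3, h4⟩
      · linarith
      · refine ⟨1 - u.1 / c, u.1 / c, ?_, by positivity, by ring, ?_⟩
        · rw [sub_nonneg, div_le_one hc]; exact h4
        · ext
          · simp; field_simp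
          · simp; field_simp; linear_combination -c * h3
  refine ⟨⟨_, _, hedge, fun p' q' h => ?_⟩, fun p q h => ?_⟩
  · exact (hA' p' (h.2.subset (left_mem_segment ℝ p' q'))).1
  · obtain ⟨⟨hpq, hexp⟩, htop⟩ := h
    have hpA := hexp.subset (left_mem_segment ℝ p q)
    have hqA := hexp.subset (right_mem_segment ℝ p q)
    have hp1 : p.1 = 0 := le_antisymm (htop _ _ hedge) (hA' p hpA).1
    have hp2 : p.2 = b := (hA' p hpA).2.1 hp1
    obtain ⟨l, hl⟩ := hexp ⟨p, left_mem_segment ℝ p q⟩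
    obtain ⟨α, β, hlαβ⟩ : ∃ α β : ℝ, ∀ u : ℝ × ℝ, l u = α * u.1 + β * u.2 := by
      refine ⟨l (1, 0), l (0, 1), fun u => ?_⟩
      have : u = u.1 • ((1 : ℝ), (0 : ℝ)) + u.2 • ((0 : ℝ), (1 : ℝ)) := by ext <;> simp
      conv_lhs => rw [this, map_add, map_smul, map_smul]
      simp only [smul_eq_mul]; ring
    have hpmax : ∀ v ∈ A, l v ≤ l p :=
      ((hl ▸ left_mem_segment ℝ p q : p ∈ {x ∈ A | ∀ y ∈ A, l y ≤ l x})).2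
    have hqmax : ∀ v ∈ A, l v ≤ l q :=
      ((hl ▸ right_mem_segment ℝ p q : q ∈ {x ∈ A | ∀ y ∈ A, l y ≤ l x})).2
    have hlpq : l p = l q := le_antisymm (hqmax p hpA) (hpmax q hqA)
    have hmem : ∀ v ∈ A, l v = l p → v ∈ segment ℝ p q := fun v hv h => by
      rw [hl]; exact ⟨hv, fun y hy => (hpmax y hy).trans_eq h.symm⟩
    -- otherwise `l` is unbounded on the upward closed set `U`
    have hβ : β ≤ 0 := by
      by_contra! hβ
      set C := (l p - l (c, b - d * c)) with hC
      have hC0 : 0 ≤ C := sub_nonneg.2 (hpmax _ (hUA hcU))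
      have := hpmax _ (hUA (hup _ hcU 0 (C / β + 1) le_rfl (by positivity)))
      rw [hlαβ] at this
      have h2 : β * (C / β) = C := by field_simp
      have h3 := hlαβ (c, b - d * c)
      simp only at this h3
      linarith
    -- if `β = 0` then `l` is constant on `A`, which is unbounded
    have hβ0 : β ≠ 0 := by
      rintro rfl
      have hα : α = 0 := by
        have := hlpq
        rw [hlαβ, hlαβ, hp1] at this
        have h2 : α * q.1 = 0 := by linarith
        exact (mul_eq_zero.1 h2).resolve_right (by rw [hp1] at hpq; exact hpq.ne')
      have h1 := hmem _ (hUA (hup _ hcU q.1 0 (by linarith) le_rfl))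
        (by simp [hlαβ, hα])
      obtain ⟨s, t, hs, ht, hst, he⟩ := h1
      have h2 := congrArg Prod.fst he
      simp [hp1] at h2
      have h3 : t * q.1 ≤ q.1 := by
        have : 0 ≤ q.1 := by linarith
        nlinarith
      linarith
    have hβneg : β < 0 := lt_of_le_of_ne hβ hβ0
    have hlp : l p = β * b := by rw [hlαβ, hp1, hp2]; ring
    have hlq : α * q.1 + β * q.2 = β * b := by rw [← hlαβ, ← hlpq, hlp]
    have hq1 : 0 < q.1 := by linarith
    have hge : b ≤ d * q.1 + q.2 := by
      rcases (hA' q hqA).2.2 with h | h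
      · exact h.le
      · exact h.1.ge
    -- the linear form is a multiple of `-(d * x + y)`
    have hα1 : α ≤ d * β := by
      have h1 := hpmax _ (hUA hcU)
      rw [hlp, hlαβ] at h1
      simp only at h1
      have : c * (α - d * β) ≤ 0 := by linarith
      nlinarith
    have hα2 : d * β ≤ α := by
      have : β * (d * q.1 + q.2) ≤ β * b := mul_le_mul_of_nonpos_left hge hβ
      have : q.1 * (d * β - α) ≤ 0 := by nlinarith
      nlinarith
    have hα : α = d * β := le_antisymm hα1 hα2
    have hqc : q.1 ≤ c := by
      rcases (hA' q hqA).2.2 with h | h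
      · rw [hα] at hlq
        have : β * (d * q.1 + q.2) < β * b := mul_lt_mul_of_neg_left h hβneg
        linarith
      · exact h.2
    have hcq : c ≤ q.1 := by
      have h1 := hmem _ (hUA hcU) (by rw [hlp, hlαβ, hα]; ring)
      obtain ⟨s, t, hs, ht, hst, he⟩ := h1
      have h2 := congrArg Prod.fst he
      simp [hp1] at h2
      nlinarith
    rw [hp1]; linarith

/-! ### Orders along neighbouring arcs -/

lemma fracOrder_mono {N : ℕ} {φ ψ : ℂ → ℂ} (h : analyticOrderAt φ 0 ≤ analyticOrderAt ψ 0) :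
    fracOrder N φ ≤ fracOrder N ψ := by
  unfold fracOrder
  cases hψ : analyticOrderAt ψ 0 with
  | top => simp
  | coe b =>
    cases hφ : analyticOrderAt φ 0 with
    | top => rw [hφ, hψ] at h; simp at h
    | coe a =>
      rw [hφ, hψ, Nat.cast_le] at h
      rw [ENat.map_natCast, ENat.map_natCast, WithTop.coe_le_coe]
      gcongr

lemma min_fracOrder_le_fracOrder_add {N : ℕ} (φ ψ : ℂ → ℂ) :
    min (fracOrder N φ) (fracOrder N ψ) ≤ fracOrder N (fun s => φ s + ψ s) := by
  have h : min (analyticOrderAt φ 0) (analyticOrderAt ψ 0) ≤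
    analyticOrderAt (fun s => φ s + ψ s) 0 := le_analyticOrderAt_add
  rcases le_total (analyticOrderAt φ 0) (analyticOrderAt ψ 0) with h1 | h1
  · rw [min_eq_left h1] at h
    exact (min_le_left _ _).trans (fracOrder_mono h)
  · rw [min_eq_right h1] at h
    exact (min_le_right _ _).trans (fracOrder_mono h)

lemma fracOrder_add_eq_left_of_lt {N : ℕ} {φ ψ : ℂ → ℂ} (h : fracOrder N φ < fracOrder N ψ) :
    fracOrder N (fun s => φ s + ψ s) = fracOrder N φ := by
  have h1 : analyticOrderAt φ 0 < analyticOrderAt ψ 0 := by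
    by_contra! h2
    exact absurd (fracOrder_mono h2) (not_le.2 h)
  rw [fracOrder, fracOrder]
  congr 1
  exact analyticOrderAt_add_eq_left_of_lt h1

namespace PuiseuxArc

lemma sub_order_comm (α β : PuiseuxArc) : (α.sub β).order = (β.sub α).order := by
  have hL : 0 < α.denom * β.denom := Nat.mul_pos α.denom_pos β.denom_pos
  rw [← fracOrder_lift_sub_lift hL dvd_rfl, ← fracOrder_lift_sub_lift hL (mul_comm _ _).dvd]
  unfold fracOrder
  congr 1
  rw [← analyticOrderAt_neg]
  congr 1
  ext1 s
  simp

/-- The ultrametric inequality for the contact order of arcs. -/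
lemma min_sub_order_le (η α β : PuiseuxArc) :
    min (η.sub α).order (α.sub β).order ≤ (η.sub β).order := by
  have hL : 0 < η.denom * α.denom * β.denom :=
    Nat.mul_pos (Nat.mul_pos η.denom_pos α.denom_pos) β.denom_pos
  rw [← fracOrder_lift_sub_lift hL (Dvd.intro _ rfl),
    ← fracOrder_lift_sub_lift hL (Dvd.intro η.denom (by ring)),
    ← fracOrder_lift_sub_lift (α := η) (β := β) hL (Dvd.intro α.denom (by ring))]
  refine (min_fracOrder_le_fracOrder_add _ _).trans_eq (fracOrder_congr ?_)
  exact Eventually.of_forall fun s => by ring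

/-- Arcs with contact at least `d` cannot be told apart by their contact orders truncated at `d`. -/
lemma min_sub_order_eq {η α β : PuiseuxArc} {d : WithTop ℚ} (h : d ≤ (α.sub β).order) :
    min d (η.sub α).order = min d (η.sub β).order := by
  refine le_antisymm (le_min (min_le_left _ _) ?_) (le_min (min_le_left _ _) ?_)
  · refine le_trans (le_min (min_le_right _ _) ((min_le_left _ _).trans h)) (min_sub_order_le η α β)
  · rw [sub_order_comm] at h
    refine le_trans (le_min (min_le_right _ _) ((min_le_left _ _).trans h)) (min_sub_order_le η β α)

lemma toFun_zero_of_order_pos {α : PuiseuxArc} (h : 0 < α.order) : α.toFun 0 = 0 := by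
  by_contra h0
  have h1 : analyticOrderAt α.toFun 0 = 0 := α.analytic.analyticOrderAt_eq_zero.2 h0
  have h2 : α.order = (((0 : ℕ) : ℚ) / α.denom : ℚ) :=
    (fracOrder_eq_div_iff α.denom_pos).2 (by rw [h1]; rfl)
  rw [h2] at h
  simp at h

end PuiseuxArc

/-- A common denominator `L` of `q` and of the multiples of `1 / K`, and the numerator `p` of
`q = p / L`. -/
lemma exists_scale {q : ℚ} (hq : 0 < q) {K : ℕ} (hK : 0 < K) :
    ∃ L p : ℕ, 0 < L ∧ 0 < p ∧ K * q.den ∣ L ∧ (p : ℚ) = q * L := by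
  have hnum : ((q.num.toNat : ℕ) : ℚ) = q.num := by
    exact_mod_cast Int.toNat_of_nonneg (Rat.num_nonneg.2 hq.le)
  have h1 : 0 < q.num.toNat := by
    have := Rat.num_pos.2 hq
    omega
  refine ⟨K * q.den, K * q.num.toNat, Nat.mul_pos hK q.den_pos, Nat.mul_pos hK h1, dvd_rfl, ?_⟩
  push_cast
  rw [hnum, ← Rat.mul_den_eq_num q]; ring

namespace IsPuiseuxFactorisation

variable {G : ℂ × ℂ → ℂ} {n : ℕ} {η : Fin n → PuiseuxArc} {γ : PuiseuxArc} {q : ℚ}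

/-- Along a generic arc `γ(y) + u * y ^ q` the order of `G` is the contact sum. -/
lemma orderAlong_addMonomial (h : IsPuiseuxFactorisation G η) (hG : AnalyticAt ℂ G 0)
    (h0 : γ.toFun 0 = 0) (hq : 0 < q) :
    ∀ᶠ u : ℂ in cofinite, (γ.addMonomial u q).orderAlong G = (contactSum η γ q : ℚ) := by
  obtain ⟨M, hM, hedge⟩ := h.exists_isEdge
  obtain ⟨L, p, hL, hp, hdvd, hpq⟩ := exists_scale hq (Nat.mul_pos hM γ.denom_pos)
  have hL' : (L : ℚ) ≠ 0 := by exact_mod_cast hL.ne'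
  obtain ⟨e, P, hP, he, -⟩ := hedge γ h0 L p hL hp ((Dvd.intro _ rfl).trans hdvd)
  rw [hpq, mul_div_cancel_right₀ _ hL'] at he
  have hd2 : γ.denom * q.den ∣ L := (Dvd.intro_left M (by ring)).trans hdvd
  filter_upwards [hP.eventually_order_eq] with u hu
  rw [← PuiseuxArc.fracOrder_lift_along hL hd2 hG (PuiseuxArc.addMonomial_apply_zero h0 u hq), ← he,
    fracOrder_eq_div_iff hL, ← hu]
  congr 1
  ext1 s
  rw [PuiseuxArc.lift_addMonomial hq.le u hL hd2 hpq, PuiseuxArc.translate, add_comm]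

/-- The Newton dots of `G` relative to `γ` lie on or above the line of slope `-q` determined by the
contact sum. The number of roots with contact at least `q` with `γ` is the abscissa of the
rightmost dot on this line. -/
lemma newtonDots_supporting_line (h : IsPuiseuxFactorisation G η) (hG : AnalyticAt ℂ G 0)
    (h0 : γ.toFun 0 = 0) (hq : 0 < q) {μ : ℕ}
    (hμ : μ = Set.ncard {i | (q : WithTop ℚ) ≤ ((η i).sub γ).order}) :
    (∀ u ∈ newtonDots G γ, (contactSum η γ q : ℝ) ≤ q * u.1 + u.2 ∧
      (q * u.1 + u.2 = contactSum η γ q → u.1 ≤ μ)) ∧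
    ((μ : ℝ), (contactSum η γ q : ℝ) - q * μ) ∈ newtonDots G γ := by
  obtain ⟨M, hM, hedge⟩ := h.exists_isEdge
  obtain ⟨L, p, hL, hp, hdvd, hpq⟩ := exists_scale hq (Nat.mul_pos hM γ.denom_pos)
  have hL' : (L : ℚ) ≠ 0 := by exact_mod_cast hL.ne'
  obtain ⟨e, P, hP, he, hdeg⟩ := hedge γ h0 L p hL hp ((Dvd.intro _ rfl).trans hdvd)
  rw [hpq, mul_div_cancel_right₀ _ hL'] at he hdeg
  rw [← hμ] at hdeg
  obtain ⟨k, hk⟩ : γ.denom ∣ L := (Dvd.intro_left M rfl).trans ((Dvd.intro _ rfl).trans hdvd)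
  have hk0 : 0 < k := Nat.pos_of_ne_zero fun h => by simp [h] at hk; omega
  have hT : AnalyticAt ℂ (γ.translate G L) 0 :=
    PuiseuxArc.analyticAt_translate hL ⟨k, hk⟩ hG h0
  have hTN : AnalyticAt ℂ (γ.translate G γ.denom) 0 :=
    PuiseuxArc.analyticAt_translate γ.denom_pos dvd_rfl hG h0
  have hord : ∀ i, analyticOrderAt (xCoeff (γ.translate G L) i) 0 =
      k * analyticOrderAt (xCoeff (γ.translate G γ.denom) i) 0 := by
    intro i
    rw [← analyticOrderAt_comp_pow (hTN.xCoeff i) hk0, hk]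
    congr 1
    ext1 s
    exact γ.xCoeff_translate G k i s
  have hLR : (L : ℝ) ≠ 0 := by exact_mod_cast hL.ne'
  have hNR : (γ.denom : ℝ) ≠ 0 := by exact_mod_cast γ.denom_pos.ne'
  have hkR : (k : ℝ) ≠ 0 := by exact_mod_cast hk0.ne'
  have hLk : (L : ℝ) = γ.denom * k := by exact_mod_cast hk
  have heR : (contactSum η γ q : ℝ) = e / L := by rw [← he]; push_cast; rfl
  have hpR : (p : ℝ) = q * L := by exact_mod_cast hpq
  have hqR : (q : ℝ) = p / L := by rw [hpR]; field_simp
  have hline : ∀ i j : ℕ, (q : ℝ) * i + (j : ℝ) / γ.denom = ((p * i + k * j : ℕ) : ℝ) / L := by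
    intro i j
    rw [hqR, hLk]; push_cast; field_simp
  constructor
  · rintro u ⟨i, j, hij, rfl⟩
    rw [← PuiseuxArc.translate_self] at hij
    have h1 := order_xCoeff_le_of_taylorCoeff_ne_zero hTN hij
    obtain ⟨h2, h3⟩ := hP.le_order_xCoeff hT hp i
    rw [hord] at h2 h3
    have h4 : (((p * i : ℕ) : ℕ∞) + k * analyticOrderAt (xCoeff (γ.translate G γ.denom) i) 0) ≤
        ((p * i + k * j : ℕ) : ℕ∞) := by
      push_cast; gcongr
    have h5 : e ≤ p * i + k * j := by exact_mod_cast h2.trans h4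
    have hLpos : (0 : ℝ) < L := by exact_mod_cast hL
    simp only
    rw [heR, hline, div_le_div_iff_of_pos_right hLpos, div_left_inj' hLR]
    refine ⟨by exact_mod_cast h5, fun h6 => ?_⟩
    have h6' : p * i + k * j = e := by exact_mod_cast h6
    have h7 := h3.1 (le_antisymm (h4.trans_eq (by rw [h6'])) h2)
    rw [← hdeg]
    exact_mod_cast Polynomial.le_natDegree_of_ne_zero h7
  · have h1 : P.coeff μ ≠ 0 := by
      rw [← hdeg]; exact Polynomial.leadingCoeff_ne_zero.2 hP.ne_zero
    have h2 := (hP.le_order_xCoeff hT hp μ).2.2 h1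
    rw [hord] at h2
    have h3 : analyticOrderAt (xCoeff (γ.translate G γ.denom) μ) 0 ≠ ⊤ := by
      intro h
      rw [h, ENat.mul_top (by exact_mod_cast hk0.ne')] at h2
      simp at h2
    obtain ⟨j, hj⟩ := ENat.ne_top_iff_exists.1 h3
    rw [← hj] at h2
    have h4 : p * μ + k * j = e := by exact_mod_cast h2
    refine ⟨μ, j, ?_, ?_⟩
    · rw [← PuiseuxArc.translate_self]
      exact taylorCoeff_ne_zero_of_order_xCoeff_eq hTN hj.symm
    · congr 1
      rw [heR, sub_eq_iff_eq_add', hline, h4]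

end IsPuiseuxFactorisation

/-- Two arcs with contact at least `q` carry values of `f` with difference of order at least
`contactSum + q`. -/
lemma IsPuiseuxFactorisation.exists_le_fracOrder_increment {f : ℂ × ℂ → ℂ} {n : ℕ}
    {η : Fin n → PuiseuxArc} (h : IsPuiseuxFactorisation (partialX f) η) (hf : AnalyticAt ℂ f 0)
    {γ α : PuiseuxArc} (hγ : γ.toFun 0 = 0) {q : ℚ} (hq : 0 < q)
    (hqα : (q : WithTop ℚ) ≤ (α.sub γ).order) :
    ∃ L : ℕ, 0 < L ∧ α.denom ∣ L ∧ γ.denom ∣ L ∧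
      ((contactSum η γ q + q : ℚ) : WithTop ℚ) ≤
        fracOrder L (fun s => f (α.lift L s, s ^ L) - f (γ.lift L s, s ^ L)) := by
  obtain ⟨M, hM, hedge⟩ := h.exists_isEdge
  obtain ⟨L, p, hL, hp, hdvd, hpq⟩ :=
    exists_scale hq (Nat.mul_pos hM (Nat.mul_pos α.denom_pos γ.denom_pos))
  have hL' : (L : ℚ) ≠ 0 := by exact_mod_cast hL.ne'
  have hd1 : M * γ.denom ∣ L := (Dvd.intro (α.denom * q.den) (by ring)).trans hdvd
  have hd2 : α.denom * γ.denom ∣ L := (Dvd.intro (M * q.den) (by ring)).trans hdvd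
  have hdγ : γ.denom ∣ L := (Dvd.intro_left M rfl).trans hd1
  have hdα : α.denom ∣ L := (Dvd.intro _ rfl).trans hd2
  obtain ⟨e, P, hP, he, -⟩ := hedge γ hγ L p hL hp hd1
  have hq' : q = p / L := by rw [hpq, mul_div_cancel_right₀ _ hL']
  refine ⟨L, hL, hdα, hdγ, ?_⟩
  rw [← PuiseuxArc.partialX_translate] at hP
  have hX : (p : ℕ∞) ≤ analyticOrderAt (fun s => α.lift L s - γ.lift L s) 0 := by
    rw [← div_le_fracOrder_iff hL, ← hq', PuiseuxArc.fracOrder_lift_sub_lift hL hd2]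
    exact hqα
  have key := hP.le_order_increment (PuiseuxArc.analyticAt_translate hL hdγ hf hγ) hp
    ((PuiseuxArc.analyticAt_lift hL hdα).sub (PuiseuxArc.analyticAt_lift hL hdγ)) hX
  rw [← div_le_fracOrder_iff hL] at key
  have h1 : (((e + p : ℕ) : ℚ) / L) = contactSum η γ q + q := by
    rw [hq', ← he]; push_cast; ring
  rw [h1] at key
  refine key.trans_eq (fracOrder_congr (Eventually.of_forall fun s => ?_))
  simp [PuiseuxArc.translate]

/-- A lower bound for the order of `f` along `γ` persists along the arcs with contact at least `q`
with `γ`, as long as it does not exceed `contactSum + q`. -/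
lemma IsPuiseuxFactorisation.le_orderAlong {f : ℂ × ℂ → ℂ} {n : ℕ}
    {η : Fin n → PuiseuxArc} (h : IsPuiseuxFactorisation (partialX f) η) (hf : AnalyticAt ℂ f 0)
    {γ α : PuiseuxArc} (hγ : γ.toFun 0 = 0) (hα : α.toFun 0 = 0) {q : ℚ} (hq : 0 < q)
    (hqα : (q : WithTop ℚ) ≤ (α.sub γ).order) {r : ℚ} (hr : (r : WithTop ℚ) ≤ γ.orderAlong f)
    (hr' : r ≤ contactSum η γ q + q) : (r : WithTop ℚ) ≤ α.orderAlong f := by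
  obtain ⟨L, hL, hdα, hdγ, hle⟩ := h.exists_le_fracOrder_increment hf hγ hq hqα
  rw [← PuiseuxArc.fracOrder_lift_along hL hdα hf hα]
  rw [← PuiseuxArc.fracOrder_lift_along hL hdγ hf hγ] at hr
  refine (le_min hr ((WithTop.coe_le_coe.2 hr').trans hle)).trans
    ((min_fracOrder_le_fracOrder_add _ _).trans_eq (fracOrder_congr ?_))
  exact Eventually.of_forall fun s => by ring

/-- The order of `f` along `γ` is shared by the arcs with contact at least `q` with `γ`, provided it
is less than `contactSum + q`. -/
lemma IsPuiseuxFactorisation.orderAlong_eq {f : ℂ × ℂ → ℂ} {n : ℕ}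
    {η : Fin n → PuiseuxArc} (h : IsPuiseuxFactorisation (partialX f) η) (hf : AnalyticAt ℂ f 0)
    {γ α : PuiseuxArc} (hγ : γ.toFun 0 = 0) (hα : α.toFun 0 = 0) {q : ℚ} (hq : 0 < q)
    (hqα : (q : WithTop ℚ) ≤ (α.sub γ).order)
    (hr : γ.orderAlong f < ((contactSum η γ q + q : ℚ) : WithTop ℚ)) :
    α.orderAlong f = γ.orderAlong f := by
  obtain ⟨L, hL, hdα, hdγ, hle⟩ := h.exists_le_fracOrder_increment hf hγ hq hqα
  rw [← PuiseuxArc.fracOrder_lift_along hL hdα hf hα]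
  rw [← PuiseuxArc.fracOrder_lift_along hL hdγ hf hγ] at hr ⊢
  rw [← fracOrder_add_eq_left_of_lt (hr.trans_le hle)]
  exact fracOrder_congr (Eventually.of_forall fun s => by ring)

/-! ### Sums of truncated contact orders -/

lemma untopD_min_cast (d : ℚ) (a : WithTop ℚ) :
    (((min (d : WithTop ℚ) a).untopD 0 : ℚ) : ℝ) =
      if a = ⊤ then (d : ℝ) else min (d : ℝ) ((a.untopD 0 : ℚ) : ℝ) := by
  cases a with
  | top => simp
  | coe a =>
    rw [← WithTop.coe_min, WithTop.untopD_coe, if_neg WithTop.coe_ne_top, WithTop.untopD_coe,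
      Rat.cast_min]

lemma untopD_min_le (d : ℚ) (a : WithTop ℚ) : (min (d : WithTop ℚ) a).untopD 0 ≤ d := by
  cases a with
  | top => simp
  | coe a =>
    rw [← WithTop.coe_min, WithTop.untopD_coe]
    exact min_le_left _ _

lemma untopD_min_mono {c d : ℚ} (h : c ≤ d) (a : WithTop ℚ) :
    (min (c : WithTop ℚ) a).untopD 0 ≤ (min (d : WithTop ℚ) a).untopD 0 := by
  cases a with
  | top => simpa
  | coe a =>
    rw [← WithTop.coe_min, ← WithTop.coe_min, WithTop.untopD_coe, WithTop.untopD_coe]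
    exact min_le_min_right a h

lemma sum_untopD_min_lt {n : ℕ} {a : Fin n → WithTop ℚ} {i₀ : Fin n} (hi₀ : a i₀ = ⊤) {c d : ℚ}
    (h : c < d) : ∑ i, (min (c : WithTop ℚ) (a i)).untopD 0 <
      ∑ i, (min (d : WithTop ℚ) (a i)).untopD 0 :=
  Finset.sum_lt_sum (fun i _ => untopD_min_mono h.le (a i)) ⟨i₀, mem_univ _, by simpa [hi₀]⟩

/-- The equation `∑ i, min d (a i) = H` has a rational solution: a real one exists by the
intermediate value theorem, and it is rational because the left hand side is piecewise affine in
`d` with rational coefficients and nonzero slope. -/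
lemma exists_sum_untopD_min_eq {n : ℕ} {a : Fin n → WithTop ℚ} {i₀ : Fin n} (hi₀ : a i₀ = ⊤)
    {c H : ℚ} (hH : ∑ i, (min (c : WithTop ℚ) (a i)).untopD 0 ≤ H) :
    ∃ d : ℚ, c ≤ d ∧ ∑ i, (min (d : WithTop ℚ) (a i)).untopD 0 = H := by
  classical
  set b : Fin n → ℝ := fun i => (((a i).untopD 0 : ℚ) : ℝ) with hb
  set g : ℝ → ℝ := fun x => ∑ i, if a i = ⊤ then x else min x (b i) with hg
  have hcast : ∀ d : ℚ, ((∑ i, (min (d : WithTop ℚ) (a i)).untopD 0 : ℚ) : ℝ) = g d := by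
    intro d
    push_cast
    exact Finset.sum_congr rfl fun i _ => untopD_min_cast d (a i)
  have hcont : Continuous g := by
    refine continuous_finsetSum _ fun i _ => ?_
    split_ifs
    · exact continuous_id
    · exact continuous_id.min continuous_const
  -- the summand of index `i₀` gives `g` slope at least `1`
  have hgrow : ∀ x y, x ≤ y → g x + (y - x) ≤ g y := by
    intro x y hxy
    have h1 : ∀ i, (if a i = ⊤ then x else min x (b i)) + (if i = i₀ then y - x else 0) ≤
        if a i = ⊤ then y else min y (b i) := by
      intro i
      by_cases hi : i = i₀
      · simp [hi, hi₀]
      · simp only [hi, if_false, add_zero]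
        split_ifs
        · exact hxy
        · exact min_le_min_right _ hxy
    have h2 := Finset.sum_le_sum fun i (_ : i ∈ univ) => h1 i
    rw [Finset.sum_add_distrib] at h2
    simpa [hg] using h2
  have hc : g c ≤ H := by rw [← hcast]; exact_mod_cast hH
  have hbig : (H : ℝ) ≤ g (c + (H - g c)) := by
    have := hgrow c (c + (H - g c)) (by linarith)
    linarith
  obtain ⟨x, ⟨hcx, -⟩, hx⟩ := intermediate_value_Icc (by linarith : (c : ℝ) ≤ c + (H - g c))
    hcont.continuousOn ⟨hc, hbig⟩
  -- the indices contributing `x` itself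
  set A : Finset (Fin n) := univ.filter fun i => a i = ⊤ ∨ x ≤ b i with hA
  have hA0 : 0 < A.card := Finset.card_pos.2 ⟨i₀, by simp [hA, hi₀]⟩
  have hgx : g x = A.card * x + ∑ i ∈ univ.filter (fun i => ¬(a i = ⊤ ∨ x ≤ b i)), b i := by
    change (∑ i, if a i = ⊤ then x else min x (b i)) = _
    rw [← Finset.sum_filter_add_sum_filter_not univ fun i => a i = ⊤ ∨ x ≤ b i]
    congr 1
    · rw [← nsmul_eq_mul, ← Finset.sum_const]
      refine Finset.sum_congr rfl fun i hi => ?_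
      rcases (Finset.mem_filter.1 hi).2 with hi | hi
      · simp [hi]
      · simp [hi]
    · refine Finset.sum_congr rfl fun i hi => ?_
      simp only [Finset.mem_filter, Finset.mem_univ, true_and, not_or, not_le] at hi
      simp [hi.1, hi.2.le]
  -- solving the affine equation `g x = H` for `x`
  set d : ℚ := (H - ∑ i ∈ univ.filter (fun i => ¬(a i = ⊤ ∨ x ≤ b i)), (a i).untopD 0) / A.card
    with hd
  have hdx : (d : ℝ) = x := by
    have : (A.card : ℝ) ≠ 0 := by exact_mod_cast hA0.ne'
    rw [hd]; push_cast
    rw [div_eq_iff this, ← hx, hgx]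
    ring
  refine ⟨d, ?_, ?_⟩
  · rw [← hdx] at hcx; exact_mod_cast hcx
  · have := hcast d
    rw [hdx, hx] at this
    exact_mod_cast this

/-! ### The gradient along an arc -/

/-- The chain rule along the arc `t ↦ (a t, t ^ A)`. -/
lemma AnalyticAt.deriv_comp_arc {f : ℂ × ℂ → ℂ} (hf : AnalyticAt ℂ f 0) {a : ℂ → ℂ} {A : ℕ}
    (ha : AnalyticAt ℂ a 0) (h0 : a 0 = 0) (hA : 0 < A) :
    deriv (fun t => f (a t, t ^ A)) =ᶠ[𝓝 0] fun t =>
      _root_.partialX f (a t, t ^ A) * deriv a t +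
        t ^ (A - 1) * (A * _root_.partialY f (a t, t ^ A)) := by
  have hc : ContinuousAt (fun t : ℂ => (a t, t ^ A)) 0 := by
    have := ha.continuousAt
    fun_prop
  have t : Tendsto (fun t : ℂ => (a t, t ^ A)) (𝓝 0) (𝓝 0) := by
    have h := hc.tendsto
    rwa [show (a 0, (0 : ℂ) ^ A) = 0 by simp [h0, hA.ne']] at h
  filter_upwards [ha.eventually_analyticAt, t.eventually hf.eventually_analyticAt,
    t.eventually hf.partialX_eventuallyEq, t.eventually hf.partialY_eventuallyEq]
    with s h1 h2 h3 h4
  have h5 := h2.differentiableAt.hasFDerivAt.comp_hasDerivAt s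
    (h1.differentiableAt.hasDerivAt.prodMk (hasDerivAt_pow A s))
  have h6 : ((deriv a s, (A : ℂ) * s ^ (A - 1)) : ℂ × ℂ) =
      deriv a s • ((1 : ℂ), (0 : ℂ)) + ((A : ℂ) * s ^ (A - 1)) • ((0 : ℂ), (1 : ℂ)) := by
    ext <;> simp
  rw [h6, map_add, map_smul, map_smul] at h5
  have h7 := h5.deriv
  change deriv (fun t => f (a t, t ^ A)) s = _ at h7
  rw [h7, h3, h4]
  simp only [smul_eq_mul]
  ring

namespace PuiseuxArc

lemma analyticAt_along {α : PuiseuxArc} {G : ℂ × ℂ → ℂ} (hG : AnalyticAt ℂ G 0)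
    (h0 : α.toFun 0 = 0) : AnalyticAt ℂ (fun t => G (α.toFun t, t ^ α.denom)) 0 := by
  have := α.analytic
  exact hG.comp_of_eq (f := fun t : ℂ => (α.toFun t, t ^ α.denom)) (by fun_prop)
    (by simp [h0, α.denom_pos.ne'])

end PuiseuxArc

lemma analyticOrderAt_const_mul {g : ℂ → ℂ} (hg : AnalyticAt ℂ g 0) {c : ℂ} (hc : c ≠ 0) :
    analyticOrderAt (fun t => c * g t) 0 = analyticOrderAt g 0 := by
  have h := analyticOrderAt_mul (f := fun _ => c) (z₀ := 0) analyticAt_const hg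
  rw [analyticAt_const.analyticOrderAt_eq_zero.2 hc, zero_add] at h
  exact h

/-- Along a polar arc, `d/dy f(γ(y), y) = f_y(γ(y), y)`, whose order is one less than that of
`f(γ(y), y)`. -/
lemma orderAlong_partialY_of_partialX_eq_top {f : ℂ × ℂ → ℂ} (hf : AnalyticAt ℂ f 0)
    (hf0 : f 0 = 0) {γ : PuiseuxArc} (h0 : γ.toFun 0 = 0) (hx : γ.orderAlong (partialX f) = ⊤)
    {h : ℚ} (hh : γ.orderAlong f = h) : γ.orderAlong (partialY f) = ((h - 1 : ℚ) : WithTop ℚ) := by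
  have hN := γ.denom_pos
  have hN' : (γ.denom : ℚ) ≠ 0 := by exact_mod_cast hN.ne'
  have hφ := PuiseuxArc.analyticAt_along hf h0
  have hy := PuiseuxArc.analyticAt_along hf.partialY h0
  have hφ0 : f (γ.toFun 0, 0 ^ γ.denom) = 0 := by
    rw [h0, zero_pow hN.ne']; exact hf0
  have hne : analyticOrderAt (fun t => f (γ.toFun t, t ^ γ.denom)) 0 ≠ ⊤ := by
    rw [Ne, ← fracOrder_eq_top (N := γ.denom)]
    change ¬ γ.orderAlong f = ⊤
    rw [hh]; simp
  obtain ⟨k, hk⟩ := ENat.ne_top_iff_exists.1 hne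
  have hk0 : k ≠ 0 := by
    rintro rfl
    exact hφ.analyticOrderAt_eq_zero.1 hk.symm hφ0
  obtain ⟨k, rfl⟩ := Nat.exists_eq_succ_of_ne_zero hk0
  have h1 := (analyticOrderAt_deriv_eq_iff hφ hφ0 (n := k)).1 (by rw [← hk]; push_cast; rfl)
  have h2 : deriv (fun t => f (γ.toFun t, t ^ γ.denom)) =ᶠ[𝓝 0] fun t =>
      t ^ (γ.denom - 1) * (γ.denom * partialY f (γ.toFun t, t ^ γ.denom)) := by
    have hx' := analyticOrderAt_eq_top.1 (fracOrder_eq_top.1 hx)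
    filter_upwards [hf.deriv_comp_arc γ.analytic h0 hN, hx'] with t h3 h4
    rw [h3, h4]; simp
  have hc : (γ.denom : ℂ) ≠ 0 := by exact_mod_cast hN.ne'
  rw [analyticOrderAt_congr h2, analyticOrderAt_pow_mul (by fun_prop),
    analyticOrderAt_const_mul hy hc] at h1
  have hyne : analyticOrderAt (fun t => partialY f (γ.toFun t, t ^ γ.denom)) 0 ≠ ⊤ := by
    intro h; rw [h] at h1; simp at h1
  obtain ⟨j, hj⟩ := ENat.ne_top_iff_exists.1 hyne
  rw [← hj] at h1
  have h3 : γ.denom - 1 + j = k := by exact_mod_cast h1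
  have h4 : γ.orderAlong (partialY f) = (((j : ℚ) / γ.denom : ℚ) : WithTop ℚ) :=
    (fracOrder_eq_div_iff hN).2 hj.symm
  have h5 : γ.orderAlong f = ((((k + 1 : ℕ) : ℚ) / γ.denom : ℚ) : WithTop ℚ) :=
    (fracOrder_eq_div_iff hN).2 hk.symm
  rw [hh, WithTop.coe_inj] at h5
  rw [h4, WithTop.coe_inj, h5, div_sub_one hN']
  congr 1
  have h6 : k + 1 = γ.denom + j := by omega
  rw [h6]; push_cast; ring

/-- For an arc `α` of order at least `1`, the order of `f_y` along `α` is bounded below by those of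
`f_x` and of `d/dy f(α(y), y)`. -/
lemma le_orderAlong_partialY {f : ℂ × ℂ → ℂ} (hf : AnalyticAt ℂ f 0) {α : PuiseuxArc}
    (h0 : α.toFun 0 = 0) (hα : 1 ≤ α.order) {j : ℕ}
    (hx : (((j : ℚ) / α.denom : ℚ) : WithTop ℚ) ≤ α.orderAlong (partialX f))
    (hh : (((j : ℚ) / α.denom + 1 : ℚ) : WithTop ℚ) ≤ α.orderAlong f) :
    (((j : ℚ) / α.denom : ℚ) : WithTop ℚ) ≤ α.orderAlong (partialY f) := by
  have hA := α.denom_pos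
  have hA' : (α.denom : ℚ) ≠ 0 := by exact_mod_cast hA.ne'
  obtain ⟨A, hA1⟩ := Nat.exists_eq_succ_of_ne_zero hA.ne'
  have hφ := PuiseuxArc.analyticAt_along hf h0
  have hxa := PuiseuxArc.analyticAt_along hf.partialX h0
  have hy := PuiseuxArc.analyticAt_along hf.partialY h0
  have hαa := α.analytic
  have hφ1 : (((j + A : ℕ) : ℕ∞) + 1) ≤ analyticOrderAt (fun t => f (α.toFun t, t ^ α.denom)) 0 := by
    have : (((j + A + 1 : ℕ) : ℚ) / α.denom) = (j : ℚ) / α.denom + 1 := by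
      rw [div_add_one hA', hA1]; push_cast; ring
    rw [← this] at hh
    exact_mod_cast (div_le_fracOrder_iff hA).1 hh
  have hφ0 : f (α.toFun 0, 0 ^ α.denom) = 0 := by
    refine apply_eq_zero_of_analyticOrderAt_ne_zero
      (f := fun t => f (α.toFun t, t ^ α.denom)) (ne_of_gt (lt_of_lt_of_le ?_ hφ1))
    exact_mod_cast Nat.succ_pos _
  have h1 := (analyticOrderAt_deriv_ge_iff hφ hφ0).2 hφ1
  have h2 : (A : ℕ∞) ≤ analyticOrderAt (deriv α.toFun) 0 := by
    refine (analyticOrderAt_deriv_ge_iff hαa h0).2 ?_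
    have h3 : (1 : WithTop ℚ) = (((α.denom : ℚ) / α.denom : ℚ) : WithTop ℚ) := by
      rw [div_self hA']; rfl
    rw [h3] at hα
    have := (div_le_fracOrder_iff hA).1 hα
    rw [hA1] at this
    exact_mod_cast this
  have h3 := (div_le_fracOrder_iff hA).1 hx
  have h4 : ((j + A : ℕ) : ℕ∞) ≤
      analyticOrderAt (fun t => partialX f (α.toFun t, t ^ α.denom) * deriv α.toFun t) 0 := by
    have := analyticOrderAt_mul hxa hαa.deriv
    change _ ≤ analyticOrderAt ((fun t => partialX f (α.toFun t, t ^ α.denom)) * deriv α.toFun) 0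
    rw [this]; push_cast; gcongr
  have hc : (α.denom : ℂ) ≠ 0 := by exact_mod_cast hA.ne'
  have h5 : ((j + A : ℕ) : ℕ∞) ≤ analyticOrderAt
      (fun t => t ^ A * (α.denom * partialY f (α.toFun t, t ^ α.denom))) 0 := by
    refine (le_min h1 h4).trans (le_analyticOrderAt_sub.trans_eq (analyticOrderAt_congr ?_))
    filter_upwards [hf.deriv_comp_arc hαa h0 hA] with t ht
    have : α.denom - 1 = A := by omega
    rw [this] at ht
    rw [Pi.sub_apply, ht]; ring
  rw [analyticOrderAt_pow_mul (by fun_prop), analyticOrderAt_const_mul hy hc, Nat.cast_add,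
    add_comm (j : ℕ∞)] at h5
  exact (div_le_fracOrder_iff hA).2 ((ENat.add_le_add_iff_left (ENat.natCast_ne_top A)).1 h5)

/-- An arc of order at least `1` satisfies `ord f(γ(y), y) ≥ m` when `f` has multiplicity `m`. -/
lemma le_orderAlong_of_isMiniRegular {f : ℂ × ℂ → ℂ} (hf : AnalyticAt ℂ f 0) {m : ℕ}
    (hm : ∀ i k : ℕ, i + k < m → taylorCoeff f i k = 0) {γ : PuiseuxArc} (h0 : γ.toFun 0 = 0)
    (hγ : 1 ≤ γ.order) : ((m : ℚ) : WithTop ℚ) ≤ γ.orderAlong f := by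
  have hN := γ.denom_pos
  have hN' : (γ.denom : ℚ) ≠ 0 := by exact_mod_cast hN.ne'
  have hγa := γ.analytic
  obtain ⟨H, hH, hT⟩ := hf.exists_taylor_fst m
  have hg : (γ.denom : ℕ∞) ≤ analyticOrderAt γ.toFun 0 := by
    have h3 : (1 : WithTop ℚ) = (((γ.denom : ℚ) / γ.denom : ℚ) : WithTop ℚ) := by
      rw [div_self hN']; rfl
    rw [h3] at hγ
    exact (div_le_fracOrder_iff hN).1 hγ
  have hpow : ∀ i : ℕ, ((i * γ.denom : ℕ) : ℕ∞) ≤ analyticOrderAt (γ.toFun ^ i) 0 := by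
    intro i
    rw [analyticOrderAt_pow hγa, nsmul_eq_mul, Nat.cast_mul]
    gcongr
  have hHs := PuiseuxArc.analyticAt_along hH h0
  have h1 : ((m : ℚ)) = (((m * γ.denom : ℕ) : ℚ) / γ.denom) := by push_cast; field_simp
  have hc : ContinuousAt (fun t : ℂ => (γ.toFun t, t ^ γ.denom)) 0 := by
    have := hγa.continuousAt
    fun_prop
  have t : Tendsto (fun t : ℂ => (γ.toFun t, t ^ γ.denom)) (𝓝 0) (𝓝 0) := by
    have h := hc.tendsto
    rwa [show (γ.toFun 0, (0 : ℂ) ^ γ.denom) = 0 by simp [h0, hN.ne']] at h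
  rw [h1]
  refine (div_le_fracOrder_iff hN).2 ?_
  have hT' : (fun t => f (γ.toFun t, t ^ γ.denom)) =ᶠ[𝓝 0] fun t =>
      (∑ i ∈ range m, xCoeff f i (t ^ γ.denom) * γ.toFun t ^ i) +
        γ.toFun t ^ m * H (γ.toFun t, t ^ γ.denom) := t.eventually hT
  rw [analyticOrderAt_congr hT']
  refine le_trans (le_min (le_analyticOrderAt_sum _ fun i hi => ?_) ?_) le_analyticOrderAt_add
  · have hca := hf.xCoeff i
    have hcc : AnalyticAt ℂ (fun t => xCoeff f i (t ^ γ.denom)) 0 :=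
      hca.comp_of_eq (f := fun t : ℂ => t ^ γ.denom) (by fun_prop) (by simp [hN.ne'])
    have h2 := analyticOrderAt_mul hcc (hγa.pow i)
    change _ ≤ analyticOrderAt ((fun t => xCoeff f i (t ^ γ.denom)) * γ.toFun ^ i) 0
    have h3 : ((m - i : ℕ) : ℕ∞) ≤ analyticOrderAt (xCoeff f i) 0 :=
      le_order_xCoeff_of_taylorCoeff_eq_zero hf fun k hk => hm i k (by omega)
    rw [h2, analyticOrderAt_comp_pow hca hN]
    have h4 : m * γ.denom = γ.denom * (m - i) + i * γ.denom := by
      rw [mul_comm γ.denom, ← add_mul]; congr 1; simp at hi; omega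
    rw [h4, Nat.cast_add, Nat.cast_mul γ.denom]
    gcongr
    exact hpow i
  · have h2 := analyticOrderAt_mul (hγa.pow m) hHs
    change _ ≤ analyticOrderAt (γ.toFun ^ m * fun t => H (γ.toFun t, t ^ γ.denom)) 0
    rw [h2]
    exact (hpow m).trans le_self_add

/-! ### The gradient degree and the top edge -/

/-- No Newton dot lies on the vertical axis when `G` vanishes along `γ`. -/
lemma one_le_fst_of_mem_newtonDots {G : ℂ × ℂ → ℂ} (hG : AnalyticAt ℂ G 0) {γ : PuiseuxArc}
    (h0 : γ.toFun 0 = 0) (htop : γ.orderAlong G = ⊤) {u : ℝ × ℝ} (hu : u ∈ newtonDots G γ) :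
    1 ≤ u.1 := by
  obtain ⟨i, k, hik, rfl⟩ := hu
  rw [← PuiseuxArc.translate_self] at hik
  have hT := PuiseuxArc.analyticAt_translate γ.denom_pos dvd_rfl hG h0
  have hi : i ≠ 0 := by
    rintro rfl
    have h1 := order_xCoeff_le_of_taylorCoeff_ne_zero hT hik
    have h2 : xCoeff (γ.translate G γ.denom) 0 = fun t => G (γ.toFun t, t ^ γ.denom) := by
      ext1 t
      simp [xCoeff, PuiseuxArc.translate_self]
    rw [h2, fracOrder_eq_top.1 htop] at h1
    simp at h1
  simp only
  exact_mod_cast Nat.one_le_iff_ne_zero.2 hi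

namespace IsPuiseuxFactorisation

variable {G : ℂ × ℂ → ℂ} {n : ℕ} {η : Fin n → PuiseuxArc} {γ : PuiseuxArc} {q : ℚ}

lemma exists_le_sub_order (h : IsPuiseuxFactorisation G η) (hG : AnalyticAt ℂ G 0)
    (h0 : γ.toFun 0 = 0) (htop : γ.orderAlong G = ⊤) (hq : 0 < q) :
    ∃ i, (q : WithTop ℚ) ≤ ((η i).sub γ).order := by
  have h1 := (h.newtonDots_supporting_line hG h0 hq rfl).2
  have h2 := one_le_fst_of_mem_newtonDots hG h0 htop h1
  simp only at h2
  have h3 : Set.ncard {i | (q : WithTop ℚ) ≤ ((η i).sub γ).order} ≠ 0 := by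
    intro h; rw [h] at h2; norm_num at h2
  exact Set.nonempty_of_ncard_ne_zero h3

/-- An arc along which `G` vanishes is one of the Puiseux roots of `G`. -/
lemma exists_sub_order_eq_top (h : IsPuiseuxFactorisation G η) (hG : AnalyticAt ℂ G 0)
    (h0 : γ.toFun 0 = 0) (htop : γ.orderAlong G = ⊤) : ∃ i, ((η i).sub γ).order = ⊤ := by
  -- if all contact orders are finite, no root has contact exceeding all of them
  by_contra! hne
  set b : Fin n → ℚ := fun i => ((η i).sub γ).order.untopD 0 with hb
  obtain ⟨i, hi⟩ := h.exists_le_sub_order hG h0 htop (q := 1 + ∑ i, |b i|)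
    (by have := Finset.sum_nonneg fun i (_ : i ∈ univ) => abs_nonneg (b i); linarith)
  have h1 : ((b i : ℚ) : WithTop ℚ) = ((η i).sub γ).order := by
    obtain ⟨a, ha⟩ := WithTop.ne_top_iff_exists.1 (hne i)
    simp only [hb, ← ha, WithTop.untopD_coe]
  rw [← h1, WithTop.coe_le_coe] at hi
  have h2 := Finset.single_le_sum (fun i (_ : i ∈ univ) => abs_nonneg (b i)) (mem_univ i)
  have h3 := le_abs_self (b i)
  linarith

/-- The contact sum does not depend on the factorisation: it is an order along generic arcs. -/
lemma contactSum_eq {n' : ℕ} {η' : Fin n' → PuiseuxArc} (h : IsPuiseuxFactorisation G η)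
    (h' : IsPuiseuxFactorisation G η') (hG : AnalyticAt ℂ G 0) (h0 : γ.toFun 0 = 0) (hq : 0 < q) :
    contactSum η γ q = contactSum η' γ q := by
  obtain ⟨u, h1, h2⟩ :=
    ((h.orderAlong_addMonomial hG h0 hq).and (h'.orderAlong_addMonomial hG h0 hq)).exists
  rw [h1, WithTop.coe_inj] at h2
  exact h2

/-- The augmented polygon: the line of slope `-d` through `(0, h - 1)` supports the Newton polygon
of `f_x` and carries the top compact edge. -/
lemma topCompactEdge_augmentedNewtonPolygon {f : ℂ × ℂ → ℂ} (hf : AnalyticAt ℂ f 0)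
    (h : IsPuiseuxFactorisation (partialX f) η) (h0 : γ.toFun 0 = 0)
    (htop : γ.orderAlong (partialX f) = ⊤) (hq : 0 < q)
    (hsum : contactSum η γ q = polarOrder f γ - 1) {μ : ℕ}
    (hμ : μ = Set.ncard {i | (q : WithTop ℚ) ≤ ((η i).sub γ).order}) :
    (∃ a b, IsTopCompactEdge (augmentedNewtonPolygon f γ) a b) ∧
      ∀ a b, IsTopCompactEdge (augmentedNewtonPolygon f γ) a b → b.1 - a.1 = (μ : ℝ) := by
  obtain ⟨h1, h2⟩ := h.newtonDots_supporting_line hf.partialX h0 hq hμ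
  have h3 : ∀ u ∈ newtonDots (partialX f) γ, 1 ≤ u.1 := fun u hu =>
    one_le_fst_of_mem_newtonDots hf.partialX h0 htop hu
  have hsumR : (contactSum η γ q : ℝ) = (polarOrder f γ : ℝ) - 1 := by
    rw [hsum]; push_cast; rfl
  rw [hsumR] at h1 h2
  have hqR : (0 : ℝ) < q := by exact_mod_cast hq
  have hμ1 : (1 : ℝ) ≤ μ := h3 _ h2
  rw [augmentedNewtonPolygon, newtonRegion, convexHull_convexHull_union_left]
  refine topCompactEdge_of_supporting_line (d := (q : ℝ)) (by linarith) ?_ ⟨_, h2, le_rfl, le_rfl⟩ ?_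
  · rintro u ⟨e, he, he1, he2⟩
    refine ⟨(h3 e he).trans he1, ?_⟩
    obtain ⟨h4, h5⟩ := h1 e he
    have h6 := mul_le_mul_of_nonneg_left he1 hqR.le
    rcases (h4.trans (add_le_add h6 he2)).lt_or_eq with h7 | h7
    · exact Or.inl h7
    · refine Or.inr ⟨h7.symm, ?_⟩
      have h8 : q * u.1 = q * e.1 := by linarith
      rw [mul_left_cancel₀ hqR.ne' h8]
      exact h5 (by linarith)
  · rintro u ⟨e, he, he1, he2⟩ s t hs ht
    exact ⟨e, he, by simp only; linarith, by simp only; linarith⟩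

end IsPuiseuxFactorisation

namespace PuiseuxArc

lemma le_fracOrder_const_mul_pow {L : ℕ} (hL : 0 < L) (u : ℂ) (p : ℕ) :
    (((p : ℚ) / L : ℚ) : WithTop ℚ) ≤ fracOrder L (fun s => u * s ^ p) := by
  rw [div_le_fracOrder_iff hL, natCast_le_analyticOrderAt_zero (by fun_prop)]
  exact ⟨fun _ => u, analyticAt_const, Eventually.of_forall fun s => mul_comm _ _⟩

lemma le_sub_order_addMonomial (γ : PuiseuxArc) (u : ℂ) {q : ℚ} (hq : 0 < q) :
    (q : WithTop ℚ) ≤ ((γ.addMonomial u q).sub γ).order := by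
  obtain ⟨L, p, hL, -, hd, hpq⟩ :=
    exists_scale hq (Nat.mul_pos (Nat.mul_pos γ.denom_pos q.den_pos) γ.denom_pos)
  have hL' : (L : ℚ) ≠ 0 := by exact_mod_cast hL.ne'
  have hd1 : (γ.addMonomial u q).denom * γ.denom ∣ L := (Dvd.intro _ rfl).trans hd
  have h := le_fracOrder_const_mul_pow hL u p
  rw [hpq, mul_div_cancel_right₀ _ hL'] at h
  rw [← fracOrder_lift_sub_lift hL hd1]
  refine h.trans_eq (fracOrder_congr (Eventually.of_forall fun s => ?_))
  change u * s ^ p = (γ.addMonomial u q).lift L s - γ.lift L s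
  rw [lift_addMonomial hq.le u hL ((Dvd.intro _ rfl).trans hd1) hpq]
  ring

/-- The ultrametric inequality for `α = (α - γ) + γ`. -/
lemma min_order_le (α γ : PuiseuxArc) : min (α.sub γ).order γ.order ≤ α.order := by
  have hL : 0 < α.denom * γ.denom := Nat.mul_pos α.denom_pos γ.denom_pos
  rw [← fracOrder_lift_sub_lift hL dvd_rfl, ← fracOrder_lift hL (Dvd.intro_left _ rfl),
    ← fracOrder_lift (α := α) hL (Dvd.intro _ rfl)]
  refine (min_fracOrder_le_fracOrder_add _ _).trans_eq (fracOrder_congr ?_)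
  exact Eventually.of_forall fun s => by ring

end PuiseuxArc

/-- The gradient degree of a polar arc is the solution `d ≥ 1` of `contactSum η γ d = h - 1`. -/
lemma IsPuiseuxFactorisation.isGradientDegree {f : ℂ × ℂ → ℂ} (hf : AnalyticAt ℂ f 0)
    (hf0 : f 0 = 0) {n : ℕ} {η : Fin n → PuiseuxArc} (h : IsPuiseuxFactorisation (partialX f) η)
    {γ : PuiseuxArc} (hγ : 1 ≤ γ.order) (htop : γ.orderAlong (partialX f) = ⊤) {d r : ℚ}
    (hr : γ.orderAlong f = r) (hd : 1 ≤ d) (hsum : contactSum η γ d = r - 1) :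
    IsGradientDegree f γ d := by
  have h0 : γ.toFun 0 = 0 := PuiseuxArc.toFun_zero_of_order_pos (lt_of_lt_of_le zero_lt_one hγ)
  have hd0 : 0 < d := by linarith
  have hgrad : γ.gradOrder f = ((r - 1 : ℚ) : WithTop ℚ) := by
    rw [PuiseuxArc.gradOrder, htop, orderAlong_partialY_of_partialX_eq_top hf hf0 h0 htop hr,
      min_eq_right le_top]
  refine ⟨⟨hd0, ?_⟩, fun q hq => ?_⟩
  -- along `γ(y) + u * y ^ d` the order of `f_x` is `h - 1` and that of `f_y` is at least `h - 1`
  · filter_upwards [h.orderAlong_addMonomial hf.partialX h0 hd0] with u hu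
    have hα0 := PuiseuxArc.addMonomial_apply_zero h0 u hd0
    have hsub := γ.le_sub_order_addMonomial u hd0
    set α := γ.addMonomial u d with hα
    have hα1 : 1 ≤ α.order :=
      le_trans (le_min (le_trans (by exact_mod_cast hd) hsub) hγ) (α.min_order_le γ)
    have hfα : ((r : ℚ) : WithTop ℚ) ≤ α.orderAlong f :=
      h.le_orderAlong hf h0 hα0 hd0 hsub hr.ge (by rw [hsum]; linarith)
    rw [hsum] at hu
    have hne : analyticOrderAt (fun t => partialX f (α.toFun t, t ^ α.denom)) 0 ≠ ⊤ := by
      rw [Ne, ← fracOrder_eq_top (N := α.denom)]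
      change ¬ α.orderAlong (partialX f) = ⊤
      rw [hu]; simp
    obtain ⟨j, hj⟩ := ENat.ne_top_iff_exists.1 hne
    have hj' : α.orderAlong (partialX f) = (((j : ℚ) / α.denom : ℚ) : WithTop ℚ) :=
      (fracOrder_eq_div_iff α.denom_pos).2 hj.symm
    have hrj : r - 1 = (j : ℚ) / α.denom := by
      rw [hu, WithTop.coe_inj] at hj'; exact hj'
    have hy := le_orderAlong_partialY hf hα0 hα1 hj'.ge (by rwa [← hrj, sub_add_cancel])
    rw [hgrad, PuiseuxArc.gradOrder, hj', min_eq_left hy, hrj]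
  -- for `q < d` already `f_x` has order less than `h - 1` along a generic arc
  · by_contra! hlt
    obtain ⟨i₀, hi₀⟩ := h.exists_sub_order_eq_top hf.partialX h0 htop
    have h1 : contactSum η γ q < contactSum η γ d := sum_untopD_min_lt hi₀ hlt
    obtain ⟨u, h2, h3⟩ := (hq.2.and (h.orderAlong_addMonomial hf.partialX h0 hq.1)).exists
    have h4 : (γ.addMonomial u q).gradOrder f ≤ ((contactSum η γ q : ℚ) : WithTop ℚ) :=
      (min_le_left _ _).trans_eq h3
    rw [← h2, hgrad, WithTop.coe_le_coe] at h4
    linarith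

/-- `f_x (x, 0)` vanishes to order exactly `m - 1` when `f` is mini-regular of order `m`. -/
lemma analyticOrderAt_partialX_of_isMiniRegular {f : ℂ × ℂ → ℂ} (hf : AnalyticAt ℂ f 0) {n : ℕ}
    (hm : IsMiniRegular f (n + 1)) :
    analyticOrderAt (fun x => partialX f (x, 0)) 0 = (n : ℕ∞) := by
  have hfx : AnalyticAt ℂ (fun x : ℂ => partialX f (x, 0)) 0 :=
    hf.partialX.comp_of_eq (f := fun x : ℂ => (x, (0 : ℂ))) (by fun_prop) rfl
  have h1 : ∀ i, iteratedDeriv i (fun x => partialX f (x, 0)) 0 =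
      taylorCoeff f (i + 1) 0 * ((i + 1).factorial : ℂ) := by
    intro i
    have h2 : ((i + 1).factorial : ℂ) ≠ 0 := by exact_mod_cast (i + 1).factorial_ne_zero
    change iteratedDeriv i (deriv fun x => f (x, 0)) 0 = _
    rw [taylorCoeff, ← iteratedDeriv_succ', iteratedDeriv_zero]
    simp only [Nat.factorial_zero, Nat.cast_one, mul_one]
    field_simp
  rw [analyticOrderAt_eq_nat_iff_iteratedDeriv_eq_zero hfx]
  refine ⟨fun k hk => ?_, ?_⟩
  · rw [h1, hm.1 (k + 1) 0 (by omega), zero_mul]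
  · rw [h1]
    exact mul_ne_zero hm.2 (by exact_mod_cast (n + 1).factorial_ne_zero)

theorem mainTheorem4 (f : ℂ × ℂ → ℂ) (hf : AnalyticAt ℂ f 0) (hf0 : f 0 = 0)
    (m : ℕ) (hm : IsMiniRegular f m) (γ : PuiseuxArc) (hγ : IsPolarArc f γ) :
    (∃ d : ℚ, IsGradientDegree f γ d) ∧
    ∀ d : ℚ, IsGradientDegree f γ d →
      (∃ μ : ℕ, IsPolarMultiplicity f (gradientCanyon γ d) μ) ∧
      ∀ μ : ℕ, IsPolarMultiplicity f (gradientCanyon γ d) μ →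
        ∀ γ' ∈ gradientCanyon γ d, IsPolarArc f γ' → (γ' = γ ∨ 1 < d) →
          (∃ p q : ℝ × ℝ, IsTopCompactEdge (augmentedNewtonPolygon f γ') p q) ∧
          ∀ p q : ℝ × ℝ, IsTopCompactEdge (augmentedNewtonPolygon f γ') p q →
            q.1 - p.1 = (μ : ℝ) := by
  obtain ⟨hγ1, hγf, htop⟩ := hγ
  have h0 : γ.toFun 0 = 0 := PuiseuxArc.toFun_zero_of_order_pos (lt_of_lt_of_le zero_lt_one hγ1)
  obtain ⟨r, hr⟩ := WithTop.ne_top_iff_exists.1 hγf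
  obtain ⟨n, rfl⟩ : ∃ n, m = n + 1 := by
    refine Nat.exists_eq_succ_of_ne_zero ?_
    rintro rfl
    refine hm.2 ?_
    have : f (0, 0) = 0 := hf0
    simp [taylorCoeff, this]
  obtain ⟨η, hη⟩ := exists_isPuiseuxFactorisation hf.partialX
    (analyticOrderAt_partialX_of_isMiniRegular hf hm)
  have hmr : ((n + 1 : ℕ) : ℚ) ≤ r := by
    have := le_orderAlong_of_isMiniRegular hf hm.1 h0 hγ1
    rw [← hr] at this
    exact_mod_cast this
  obtain ⟨i₀, hi₀⟩ := hη.exists_sub_order_eq_top hf.partialX h0 htop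
  -- `contactSum η γ 1 ≤ m - 1 ≤ h - 1`, so the solution `d` is at least `1`
  have h1 : ∑ i, (min ((1 : ℚ) : WithTop ℚ) ((η i).sub γ).order).untopD 0 ≤ r - 1 := by
    refine (Finset.sum_le_sum fun i _ => untopD_min_le 1 _).trans ?_
    push_cast at hmr
    simp
    linarith
  obtain ⟨d₀, hd₀, hsum⟩ := exists_sum_untopD_min_eq hi₀ h1
  have hdeg := hη.isGradientDegree hf hf0 hγ1 htop hr.symm hd₀ hsum
  refine ⟨⟨d₀, hdeg⟩, fun d hd => ?_⟩
  obtain rfl : d = d₀ := hd.unique hdeg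
  have hd0 : 0 < d := by linarith
  refine ⟨⟨_, n, η, hη, rfl⟩, ?_⟩
  rintro μ ⟨n', η', hη', hμ⟩ γ' hγ' ⟨hγ'1, -, htop'⟩ hor
  have h0' : γ'.toFun 0 = 0 := PuiseuxArc.toFun_zero_of_order_pos (lt_of_lt_of_le zero_lt_one hγ'1)
  have hsum' : contactSum η' γ d = r - 1 := (hη'.contactSum_eq hη hf.partialX h0 hd0).trans hsum
  -- truncated at `d`, the contact orders with `γ` and with `γ'` agree
  have hmin : ∀ i, min (d : WithTop ℚ) ((η' i).sub γ').order =
      min (d : WithTop ℚ) ((η' i).sub γ).order :=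
    fun i => PuiseuxArc.min_sub_order_eq hγ'
  have hsum'' : contactSum η' γ' d = r - 1 := by
    rw [← hsum', contactSum, contactSum]
    exact Finset.sum_congr rfl fun i _ => by rw [hmin]
  -- for `d > 1`, `f` changes along the canyon only in orders `≥ (h - 1) + d > h`
  have hord : γ'.orderAlong f = γ.orderAlong f := by
    rcases hor with rfl | h1d
    · rfl
    · refine hη'.orderAlong_eq hf h0 h0' hd0 hγ' ?_
      rw [← hr, hsum', WithTop.coe_lt_coe]
      linarith
  refine hη'.topCompactEdge_augmentedNewtonPolygon hf h0' htop' hd0 ?_ ?_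
  · rw [hsum'', polarOrder, hord, ← hr, WithTop.untopD_coe]
  · rw [hμ]
    congr 1
    ext i
    change (d : WithTop ℚ) ≤ ((η' i).sub γ).order ↔ (d : WithTop ℚ) ≤ ((η' i).sub γ').order
    rw [← min_eq_left_iff, ← min_eq_left_iff, hmin]
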